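/- Let $m\in\mathbb{Q}[X,Y,Z]$ be irreducible over $\mathbb{Q}$ and let $\mathcal{M}$ be the surface of real points with $m=0$ and $\nabla m\neq 0$, or more generally a relatively open subset of the set of these points. For a finite simple graph $G=(V,E)$ with $V\ne\emptyset$, a framework $(G,p)$ on $\mathcal{M}$ is given by points $p=(p_v)_{v\in V}$, $p_v\in\mathcal{M}$. Its rigidity matrix $R_{\mathcal{M}}(G,p)$ is the $(|E|+|V|)\times 3|V|$ matrix with, for each edge $ab\in E$, a row with entries $p_a-p_b$ in the three columns of $a$, $p_b-p_a$ in the three columns of $b$ and $0$ elsewhere, and, for each vertex $v$, a row with entries $\nabla m(p_v)$ in the three columns of $v$ and $0$ elsewhere. The surface $\mathcal{M}$ is of type $k$ if $k$ is the largest integer such that $\dim\ker R_{\mathcal{M}}(K_n,q)\ge k$ for all $n\ge 2$ and all complete frameworks $(K_n,q)$ on $\mathcal{M}$. The framework $(G,p)$ is generic on $\mathcal{M}$ if every polynomial $h$ with rational coefficients in the variables $X_v,Y_v,Z_v$ $(v\in V)$ that vanishes at the coordinates of the points $p_v$ lies in the ideal of $\mathbb{Q}[X_v,Y_v,Z_v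 : v\in V]$ generated by the polynomials $m(X_v,Y_v,Z_v)$, $v\in V$. An infinitesimal flex of $(G,p)$ on $\mathcal{M}$ is a family $(u_v)_{v\in V}$ of vectors in $\mathbb{R}^3$ with $u_v\cdot\nabla m(p_v)=0$ for all $v\in V$ and $u_a\cdot(p_a-p_b)=u_b\cdot(p_a-p_b)$ for all $ab\in E$. The framework is infinitesimally rigid on $\mathcal{M}$ if for every infinitesimal flex $u$ on $\mathcal{M}$ there are $\omega,t\in\mathbb{R}^3$ with $u_v=\omega\times p_v+t$ for all $v\in V$; it is independent if the rows of $R_{\mathcal{M}}(G,p)$ are linearly independent; and it is isostatic on $\mathcal{M}$ if it is both independent and infinitesimally rigid on $\mathcal{M}$. The graph $G$ is $(2,1)$-tight if $|E|=2|V|-1$ and $|E(H)|\le 2|V(H)|-1$ for every subgraph $H$ of $G$ with at least one edge. Theorem. Suppose that $\mathcal{M}$ is of type $1$ and that $(G,p)$ is a generic framework on $\mathcal{M}$. Then $(G,p)$ is isostatic on $\mathcal{M}$ if and only if $G$ is (isomorphic to) $K_1$, $K_2$, $K_3$ or $K_4$, or $G$ is $(2,1)$-tight. -/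

import Mathlib

open MvPolynomial Matrix

noncomputable section

namespace SurfaceFramework

/-- The gradient `∇m(x)` of a rational polynomial `m` in three variables at a point `x ∈ ℝ³`. -/
def grad (m : MvPolynomial (Fin 3) ℚ) (x : Fin 3 → ℝ) : Fin 3 → ℝ :=
  fun i => aeval x (pderiv i m)

/-- The nonsingular real points of the equation `m = 0`. -/
def nonsingularLocus (m : MvPolynomial (Fin 3) ℚ) : Set (Fin 3 → ℝ) :=
  {x | aeval x m = 0 ∧ grad m x ≠ 0}

/-- `M` is an irreducible algebraic surface with defining polynomial `m`: the polynomial `m` is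
irreducible over `ℚ`, and `M` is an open part (possibly all) of the nonsingular real points of
`m = 0`; equivalently, `M` is a 2-dimensional embedded manifold consisting of such points. -/
def IsIrreducibleSurface (m : MvPolynomial (Fin 3) ℚ) (M : Set (Fin 3 → ℝ)) : Prop :=
  Irreducible m ∧ ∃ U : Set (Fin 3 → ℝ), IsOpen U ∧ M = U ∩ nonsingularLocus m

variable {V : Type*}

/-- The row of the rigidity matrix of an edge `e = ab`: the entries in the columns of `a` are the
coordinates of `p a - p b`, those in the columns of `b` are the coordinates of `p b - p a`, and
all other entries vanish. -/
def edgeRow [DecidableEq V] (p : V → Fin 3 → ℝ) (e : Sym2 V) : V × Fin 3 → ℝ :=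
  fun c => Sym2.lift
    ⟨fun a b => (if c.1 = a then p a c.2 - p b c.2 else 0) +
      (if c.1 = b then p b c.2 - p a c.2 else 0), fun _ _ => add_comm _ _⟩ e

/-- The row of the rigidity matrix of a vertex `v`: the normal vector `∇m(p v)` in the columns
of `v`, and zero elsewhere. -/
def vertexRow [DecidableEq V] (m : MvPolynomial (Fin 3) ℚ) (p : V → Fin 3 → ℝ) (v : V) :
    V × Fin 3 → ℝ :=
  fun c => if c.1 = v then grad m (p v) c.2 else 0

/-- The rigidity matrix of the framework `(G, p)` on the surface defined by `m`. -/
def rigidityMatrix [DecidableEq V] (m : MvPolynomial (Fin 3) ℚ) (G : SimpleGraph V)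
    (p : V → Fin 3 → ℝ) : Matrix (G.edgeSet ⊕ V) (V × Fin 3) ℝ :=
  Matrix.of (Sum.elim (fun e => edgeRow p e.1) (vertexRow m p))

/-- The surface `M` (with defining polynomial `m`) has type `k`: the rigidity matrix of every
complete framework on `M` has a kernel of dimension at least `k`, and `k` is largest possible. -/
def HasType (m : MvPolynomial (Fin 3) ℚ) (M : Set (Fin 3 → ℝ)) (k : ℕ) : Prop :=
  IsGreatest {d : ℕ | ∀ n : ℕ, 2 ≤ n → ∀ p : Fin n → Fin 3 → ℝ, (∀ i, p i ∈ M) →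
    d ≤ Module.finrank ℝ
      (LinearMap.ker (rigidityMatrix m (⊤ : SimpleGraph (Fin n)) p).mulVecLin)} k

/-- The vector of points `p` is generic on the surface defined by `m`: every algebraic
dependency `h = 0` over `ℚ` between the coordinates of all the points `p v` lies in the ideal
generated by the polynomials `m(X_v, Y_v, Z_v)`. -/
def IsGeneric (m : MvPolynomial (Fin 3) ℚ) (p : V → Fin 3 → ℝ) : Prop :=
  ∀ h : MvPolynomial (V × Fin 3) ℚ, aeval (fun c : V × Fin 3 => p c.1 c.2) h = 0 →
    h ∈ Ideal.span (Set.range fun v : V => rename (fun i : Fin 3 => (v, i)) m)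

/-- `u` is an infinitesimal flex of `(G, p)` on the surface defined by `m`: each velocity is
tangential to the surface, and `u_a · (p_a - p_b) = u_b · (p_a - p_b)` for every edge `ab`. -/
def IsInfinitesimalFlex (m : MvPolynomial (Fin 3) ℚ) (G : SimpleGraph V)
    (p u : V → Fin 3 → ℝ) : Prop :=
  (∀ v, u v ⬝ᵥ grad m (p v) = 0) ∧
    ∀ a b, G.Adj a b → u a ⬝ᵥ (p a - p b) = u b ⬝ᵥ (p a - p b)

/-- `u` is induced by an infinitesimal rigid motion `x ↦ ω × x + t` of `ℝ³`. -/
def IsRigidMotion (p u : V → Fin 3 → ℝ) : Prop :=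
  ∃ ω t : Fin 3 → ℝ, ∀ v, u v = ω ⨯₃ (p v) + t

/-- `(G, p)` is infinitesimally rigid on the surface: every infinitesimal flex on the surface
comes from a rigid motion. -/
def IsInfinitesimallyRigid (m : MvPolynomial (Fin 3) ℚ) (G : SimpleGraph V)
    (p : V → Fin 3 → ℝ) : Prop :=
  ∀ u : V → Fin 3 → ℝ, IsInfinitesimalFlex m G p u → IsRigidMotion p u

/-- `(G, p)` is independent on the surface: its rigidity matrix has linearly independent rows. -/
def IsIndependent [DecidableEq V] (m : MvPolynomial (Fin 3) ℚ) (G : SimpleGraph V)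
    (p : V → Fin 3 → ℝ) : Prop :=
  LinearIndependent ℝ (rigidityMatrix m G p).row

/-- `(G, p)` is isostatic (minimally infinitesimally rigid) on the surface. -/
def IsIsostatic [DecidableEq V] (m : MvPolynomial (Fin 3) ℚ) (G : SimpleGraph V)
    (p : V → Fin 3 → ℝ) : Prop :=
  IsIndependent m G p ∧ IsInfinitesimallyRigid m G p

/-- `G` is `(2, k)`-sparse: `|E(H)| ≤ 2 |V(H)| - k` for every subgraph `H` with an edge. -/
def IsSparse (G : SimpleGraph V) (k : ℕ) : Prop :=
  ∀ H : G.Subgraph, H.edgeSet.Nonempty →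
    (H.edgeSet.ncard : ℤ) ≤ 2 * (H.verts.ncard : ℤ) - k

/-- `G` is `(2, k)`-tight: it is `(2, k)`-sparse and `|E| = 2 |V| - k`. -/
def IsTight (G : SimpleGraph V) (k : ℕ) : Prop :=
  IsSparse G k ∧ (G.edgeSet.ncard : ℤ) = 2 * (Nat.card V : ℤ) - k

end SurfaceFramework

end

open MvPolynomial Matrix

noncomputable section

namespace SurfaceFramework

/-! ### Vectors in `ℝ³` -/

/-! A rigid motion `x ↦ ω × x + t` is tangential at a point exactly when its six coordinates are
orthogonal to the vector `(x × n, n)` of the normal line there. Type one forces the motions that are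
tangential along all of `M`, the slides, to form a line (`HasType.finrank_slides`). So the normal
lines at five generic points are independent, and a rigid framework on at least five vertices has a
kernel of dimension at most one. Conversely every framework with at least two vertices has a nonzero
flex. Counting rows and columns of an independent rigidity matrix then gives sparsity, and rigidity
gives tightness. On at most four vertices the complete graph is independent, so only the complete
graph is rigid.

An independent tight framework has a one-dimensional kernel, spanned by the flex of the complete
framework, which is a rigid motion. The core is therefore that sparse graphs are independent. This
is proved by induction on the number of edges for graphs with loops (`GenericOn.loopIndependent`), a
loop at `a` making the velocity of `a` parallel to the slide. Sparsity provides a vertex `v` of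
degree at most three. Up to degree two its equations are solvable outright. Suppose that degree
three fails. By genericity it fails for every position `x ∈ M` of `v`, so a 4 × 4 determinant
vanishes along `M`. Its derivative at a neighbour `x = p a` shows that every flex of the rest
satisfies the constraints joining `a` to the other neighbours, a loop at `v` becoming a loop at `a`.
If `v` has no loop, its three neighbours thus move rigidly; that motion must be a slide, so loops at
the neighbours are satisfied too. By induction each such edge or loop is either present or blocked
by a tight set. These tight sets merge into one containing all neighbours of `v`, and three more
edges at `v` violate sparsity.

Genericity speaks of polynomials over ℚ, so the slide in the loop constraints must be rational; six
generic points ensure this (`HasType.exists_rational_slide`). A tight graph on five vertices is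
instead a `K₅` lacking an edge, and its independence comes directly from the five independent normal
lines. -/

theorem cross_apply_zero (x y : Fin 3 → ℝ) : (x ⨯₃ y) 0 = x 1 * y 2 - x 2 * y 1 := by
  simp [cross_apply]

theorem cross_apply_one (x y : Fin 3 → ℝ) : (x ⨯₃ y) 1 = x 2 * y 0 - x 0 * y 2 := by
  simp [cross_apply]

theorem cross_apply_two (x y : Fin 3 → ℝ) : (x ⨯₃ y) 2 = x 0 * y 1 - x 1 * y 0 := by
  simp [cross_apply]

theorem dotProduct_three (x y : Fin 3 → ℝ) : x ⬝ᵥ y = x 0 * y 0 + x 1 * y 1 + x 2 * y 2 := by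
  simp [dotProduct, Fin.sum_univ_three]

/-- The scalar triple product. -/
def triple (x y z : Fin 3 → ℝ) : ℝ := x ⬝ᵥ (y ⨯₃ z)

theorem exists_dotProduct_eq_of_triple_ne_zero {x y z : Fin 3 → ℝ} (h : triple x y z ≠ 0)
    (α β γ : ℝ) : ∃ u : Fin 3 → ℝ, u ⬝ᵥ x = α ∧ u ⬝ᵥ y = β ∧ u ⬝ᵥ z = γ := by
  refine ⟨(triple x y z)⁻¹ • (α • (y ⨯₃ z) + β • (z ⨯₃ x) + γ • (x ⨯₃ y)), ?_, ?_, ?_⟩ <;>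
  · rw [smul_dotProduct, smul_eq_mul, inv_mul_eq_iff_eq_mul₀ h]
    simp only [triple, dotProduct_three, cross_apply_zero, cross_apply_one, cross_apply_two,
      Pi.add_apply, Pi.smul_apply, smul_eq_mul]
    ring

theorem exists_dotProduct_eq_of_cross_ne_zero {x y : Fin 3 → ℝ} (h : x ⨯₃ y ≠ 0) (α β : ℝ) :
    ∃ u : Fin 3 → ℝ, u ⬝ᵥ x = α ∧ u ⬝ᵥ y = β := by
  have h' : triple (x ⨯₃ y) x y ≠ 0 := by
    unfold triple
    exact fun h0 => h (dotProduct_self_eq_zero.1 h0)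
  obtain ⟨u, -, h1, h2⟩ := exists_dotProduct_eq_of_triple_ne_zero h' 0 α β
  exact ⟨u, h1, h2⟩

theorem eq_zero_of_triple_ne_zero {x y z u : Fin 3 → ℝ} (h : triple x y z ≠ 0)
    (h1 : u ⬝ᵥ x = 0) (h2 : u ⬝ᵥ y = 0) (h3 : u ⬝ᵥ z = 0) : u = 0 := by
  have key : ∀ i, triple x y z * u i = 0 := by
    intro i
    have : triple x y z • u = (u ⬝ᵥ x) • (y ⨯₃ z) + (u ⬝ᵥ y) • (z ⨯₃ x) + (u ⬝ᵥ z) • (x ⨯₃ y) := by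
      ext j
      fin_cases j <;>
      · simp [triple, dotProduct, Fin.sum_univ_three, cross_apply]
        ring
    have h' := congrFun this i
    simpa [h1, h2, h3] using h'
  ext i
  simpa [h] using key i

theorem exists_ne_zero_dotProduct_eq_zero (x y : Fin 3 → ℝ) :
    ∃ s : Fin 3 → ℝ, s ≠ 0 ∧ s ⬝ᵥ x = 0 ∧ s ⬝ᵥ y = 0 := by
  have h : ∃ s : Fin 3 → ℝ, s ≠ 0 ∧ (Matrix.of ![x, y]) *ᵥ s = 0 := by
    have h := LinearMap.ker_ne_bot_of_finrank_lt (f := (Matrix.of ![x, y]).mulVecLin) (by simp)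
    obtain ⟨s, hs, h0⟩ := Submodule.exists_mem_ne_zero_of_ne_bot h
    exact ⟨s, h0, by simpa using hs⟩
  obtain ⟨s, hs, h0⟩ := h
  refine ⟨s, hs, ?_, ?_⟩
  · simpa [mulVec, dotProduct_comm] using congrFun h0 0
  · simpa [mulVec, dotProduct_comm] using congrFun h0 1

/-- Solvability of a `4 × 4` linear system whose determinant is the given number. -/
theorem exists_solution_of_ne_zero {g r s n : Fin 3 → ℝ} {A B C : ℝ}
    (h : g ⬝ᵥ (A • (s ⨯₃ n) - B • (r ⨯₃ n) + C • (r ⨯₃ s)) ≠ 0) (t₁ t₂ t₃ t₄ : ℝ) :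
    ∃ (y : Fin 3 → ℝ) (l : ℝ), y ⬝ᵥ g = t₁ ∧ y ⬝ᵥ r - l * A = t₂ ∧ y ⬝ᵥ s - l * B = t₃ ∧
      y ⬝ᵥ n - l * C = t₄ := by
  set N : Matrix (Fin 4) (Fin 4) ℝ := Matrix.of ![![g 0, g 1, g 2, 0], ![r 0, r 1, r 2, -A],
    ![s 0, s 1, s 2, -B], ![n 0, n 1, n 2, -C]] with hN
  -- The number in `h` is minus the determinant, expanded along the last column.
  have hdet : N.det ≠ 0 := by
    intro h0
    apply h
    rw [hN, Matrix.det_succ_row_zero] at h0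
    simp [Fin.sum_univ_succ, Matrix.det_fin_three, Fin.succAbove] at h0
    simp only [dotProduct_three, cross_apply_zero, cross_apply_one, cross_apply_two,
      Pi.add_apply, Pi.sub_apply, Pi.smul_apply, smul_eq_mul]
    linear_combination -h0
  have hsurj := Matrix.mulVec_surjective_iff_isUnit.2
    ((Matrix.isUnit_iff_isUnit_det _).2 (isUnit_iff_ne_zero.2 hdet))
  obtain ⟨w, hw⟩ := hsurj ![t₁, t₂, t₃, t₄]
  refine ⟨![w 0, w 1, w 2], w 3, ?_, ?_, ?_, ?_⟩
  · have := congrFun hw 0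
    simp [hN, mulVec, dotProduct, Fin.sum_univ_succ] at this
    simp [dotProduct, Fin.sum_univ_three]
    linarith
  · have := congrFun hw 1
    simp [hN, mulVec, dotProduct, Fin.sum_univ_succ] at this
    simp [dotProduct, Fin.sum_univ_three]
    linarith
  · have := congrFun hw 2
    simp [hN, mulVec, dotProduct, Fin.sum_univ_succ] at this
    simp [dotProduct, Fin.sum_univ_three]
    linarith
  · have := congrFun hw 3
    simp [hN, mulVec, dotProduct, Fin.sum_univ_succ] at this
    simp [dotProduct, Fin.sum_univ_three]
    linarith

/-- `|e₁ × e₂|²` times the angular velocity `ω` with `ω × e₁ = d₁` and `ω × e₂ = d₂`. -/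
def scaledAngular (e₁ e₂ d₁ d₂ : Fin 3 → ℝ) : Fin 3 → ℝ :=
  (d₁ ⬝ᵥ e₂) • (e₁ ⨯₃ e₂) + (d₂ ⬝ᵥ (e₁ ⨯₃ e₂)) • e₁ - (d₁ ⬝ᵥ (e₁ ⨯₃ e₂)) • e₂

/-- The hypotheses are the relations that `ω × e₁ = d₁` and `ω × e₂ = d₂` impose on the data. Given
them, both sides have equal inner products with the basis `e₁ × e₂`, `e₁`, `e₂`. -/
theorem scaledAngular_cross {e₁ e₂ d₁ d₂ : Fin 3 → ℝ} (h : e₁ ⨯₃ e₂ ≠ 0) (h1 : d₁ ⬝ᵥ e₁ = 0)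
    (h2 : d₂ ⬝ᵥ e₂ = 0) (h12 : d₁ ⬝ᵥ e₂ + d₂ ⬝ᵥ e₁ = 0) :
    scaledAngular e₁ e₂ d₁ d₂ ⨯₃ e₁ = ((e₁ ⨯₃ e₂) ⬝ᵥ (e₁ ⨯₃ e₂)) • d₁ ∧
    scaledAngular e₁ e₂ d₁ d₂ ⨯₃ e₂ = ((e₁ ⨯₃ e₂) ⬝ᵥ (e₁ ⨯₃ e₂)) • d₂ := by
  have hne : triple (e₁ ⨯₃ e₂) e₁ e₂ ≠ 0 := by
    unfold triple
    exact fun h0 => h (dotProduct_self_eq_zero.1 h0)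
  simp only [dotProduct_three] at h1 h2 h12
  constructor
  · rw [← sub_eq_zero]
    apply eq_zero_of_triple_ne_zero hne <;>
      simp only [scaledAngular, dotProduct_three, cross_apply_zero, cross_apply_one, cross_apply_two,
      Pi.add_apply, Pi.sub_apply, Pi.smul_apply, smul_eq_mul]
    · ring
    · linear_combination (-((e₁ 1 * e₂ 2 - e₁ 2 * e₂ 1)^2 + (e₁ 2 * e₂ 0 - e₁ 0 * e₂ 2)^2 +
        (e₁ 0 * e₂ 1 - e₁ 1 * e₂ 0)^2)) * h1
    · ring
  · rw [← sub_eq_zero]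
    apply eq_zero_of_triple_ne_zero hne <;>
      simp only [scaledAngular, dotProduct_three, cross_apply_zero, cross_apply_one, cross_apply_two,
      Pi.add_apply, Pi.sub_apply, Pi.smul_apply, smul_eq_mul]
    · ring
    · linear_combination (-((e₁ 1 * e₂ 2 - e₁ 2 * e₂ 1)^2 + (e₁ 2 * e₂ 0 - e₁ 0 * e₂ 2)^2 +
        (e₁ 0 * e₂ 1 - e₁ 1 * e₂ 0)^2)) * h12
    · linear_combination (-((e₁ 1 * e₂ 2 - e₁ 2 * e₂ 1)^2 + (e₁ 2 * e₂ 0 - e₁ 0 * e₂ 2)^2 +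
        (e₁ 0 * e₂ 1 - e₁ 1 * e₂ 0)^2)) * h2

/-- The velocity field `x ↦ ω × x + t` of the infinitesimal rigid motion `c = (ω, t)`. -/
def motion (c : Fin 3 ⊕ Fin 3 → ℝ) (x : Fin 3 → ℝ) : Fin 3 → ℝ :=
  (c ∘ Sum.inl) ⨯₃ x + c ∘ Sum.inr

theorem motion_add (c c' : Fin 3 ⊕ Fin 3 → ℝ) (x : Fin 3 → ℝ) :
    motion (c + c') x = motion c x + motion c' x := by
  ext i; fin_cases i <;> simp [motion, cross_apply_zero, cross_apply_one, cross_apply_two] <;> ring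

theorem motion_smul (a : ℝ) (c : Fin 3 ⊕ Fin 3 → ℝ) (x : Fin 3 → ℝ) :
    motion (a • c) x = a • motion c x := by
  ext i; fin_cases i <;> simp [motion, cross_apply_zero, cross_apply_one, cross_apply_two] <;> ring

theorem motion_zero (x : Fin 3 → ℝ) : motion 0 x = 0 := by
  simpa using motion_smul 0 0 x

theorem motion_sub_dotProduct (c : Fin 3 ⊕ Fin 3 → ℝ) (x y : Fin 3 → ℝ) :
    (motion c x - motion c y) ⬝ᵥ (x - y) = 0 := by
  simp [motion, cross_apply, dotProduct, Fin.sum_univ_three]; ring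

/-- An infinitesimal motion of a nondegenerate triangle that preserves its edge lengths is
rigid; the motion is given explicitly up to the positive factor `|(b - a) × (c - a)|²`. -/
theorem exists_motion_of_triangle {a b c ua ub uc : Fin 3 → ℝ} (h : (b - a) ⨯₃ (c - a) ≠ 0)
    (hab : (ua - ub) ⬝ᵥ (a - b) = 0) (hac : (ua - uc) ⬝ᵥ (a - c) = 0)
    (hbc : (ub - uc) ⬝ᵥ (b - c) = 0) :
    ∃ k : Fin 3 ⊕ Fin 3 → ℝ, motion k a = ua ∧ motion k b = ub ∧ motion k c = uc ∧
      ∀ x, (((b - a) ⨯₃ (c - a)) ⬝ᵥ ((b - a) ⨯₃ (c - a))) • motion k x =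
        scaledAngular (b - a) (c - a) (ub - ua) (uc - ua) ⨯₃ (x - a) +
          (((b - a) ⨯₃ (c - a)) ⬝ᵥ ((b - a) ⨯₃ (c - a))) • ua := by
  set N := ((b - a) ⨯₃ (c - a)) ⬝ᵥ ((b - a) ⨯₃ (c - a)) with hN
  have hN0 : N ≠ 0 := fun h0 => h (dotProduct_self_eq_zero.1 h0)
  set Ω := scaledAngular (b - a) (c - a) (ub - ua) (uc - ua) with hΩ
  have hb : Ω ⨯₃ (b - a) = N • (ub - ua) ∧ Ω ⨯₃ (c - a) = N • (uc - ua) := by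
    apply scaledAngular_cross h
    · rw [← hab]; simp [dotProduct, Fin.sum_univ_three]; ring
    · rw [← hac]; simp [dotProduct, Fin.sum_univ_three]; ring
    -- Polarization: the mixed term comes from the third side of the triangle.
    · simp [dotProduct, Fin.sum_univ_three] at hab hac hbc ⊢; linear_combination hab + hac - hbc
  have hm : ∀ x, N • motion (Sum.elim (N⁻¹ • Ω) (ua - (N⁻¹ • Ω) ⨯₃ a)) x
      = Ω ⨯₃ (x - a) + N • ua := by
    intro x
    have : motion (Sum.elim (N⁻¹ • Ω) (ua - (N⁻¹ • Ω) ⨯₃ a)) x = N⁻¹ • (Ω ⨯₃ (x - a)) + ua := by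
      simp only [motion, Sum.elim_comp_inl, Sum.elim_comp_inr, map_sub, map_smul,
        LinearMap.smul_apply, smul_sub]
      abel
    rw [this, smul_add, smul_smul, mul_inv_cancel₀ hN0, one_smul]
  have inj : ∀ y z : Fin 3 → ℝ, N • y = N • z → y = z := fun y z h =>
    smul_right_injective _ hN0 h
  refine ⟨_, inj _ _ ?_, inj _ _ ?_, inj _ _ ?_, hm⟩
  · rw [hm]; simp
  · rw [hm, hb.1, ← smul_add]; simp
  · rw [hm, hb.2, ← smul_add]; simp

/-- The vector `(x × n, n)` of a line through `x` with direction `n`. -/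
def lineVec (x n : Fin 3 → ℝ) : Fin 3 ⊕ Fin 3 → ℝ := Sum.elim (x ⨯₃ n) n

/-- This makes tangentiality at a point a single linear equation on the six coordinates of a motion.
-/
theorem dotProduct_lineVec (c : Fin 3 ⊕ Fin 3 → ℝ) (x n : Fin 3 → ℝ) :
    c ⬝ᵥ lineVec x n = motion c x ⬝ᵥ n := by
  simp [lineVec, motion, dotProduct, Fin.sum_univ_three, cross_apply]; ring

/-- An infinitesimal motion of the complete framework on points that are not coplanar is rigid. -/
theorem exists_motion_of_complete {ι : Type*} {q u : ι → Fin 3 → ℝ}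
    (hu : ∀ i j, (u i - u j) ⬝ᵥ (q i - q j) = 0) {a b c d : ι}
    (h : triple (q b - q a) (q c - q a) (q d - q a) ≠ 0) :
    ∃ k, ∀ i, u i = motion k (q i) := by
  have hn : (q b - q a) ⨯₃ (q c - q a) ≠ 0 := by
    intro h0
    apply h
    rw [triple, triple_product_permutation, triple_product_permutation, h0, dotProduct_zero]
  obtain ⟨k, ha, hb, hc, -⟩ := exists_motion_of_triangle hn (hu a b) (hu a c) (hu b c)
  -- Once `k` matches the velocity of `j`, the discrepancy at any `i` is orthogonal to the chord
  -- `ij`. Three independent chords make it vanish.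
  have step : ∀ i j, motion k (q j) = u j → (u i - motion k (q i)) ⬝ᵥ (q i - q j) = 0 := by
    intro i j hj
    have h1 := hu i j
    have h2 := motion_sub_dotProduct k (q i) (q j)
    rw [hj] at h2
    have : u i - motion k (q i) = (u i - u j) - (motion k (q i) - u j) := by abel
    rw [this, sub_dotProduct, h1, h2, sub_zero]
  have diff : ∀ (w x y z : Fin 3 → ℝ), w ⬝ᵥ (x - y) = 0 → w ⬝ᵥ (x - z) = 0 → w ⬝ᵥ (z - y) = 0 := by
    intro w x y z h1 h2
    have : z - y = (x - y) - (x - z) := by abel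
    rw [this, dotProduct_sub, h1, h2, sub_zero]
  have hd : motion k (q d) = u d := by
    have hda := step d a ha
    have hdb := step d b hb
    have hdc := step d c hc
    have := eq_zero_of_triple_ne_zero h (diff _ _ _ _ hda hdb) (diff _ _ _ _ hda hdc) hda
    exact (sub_eq_zero.1 this).symm
  refine ⟨k, fun i => ?_⟩
  have hia := step i a ha
  have := eq_zero_of_triple_ne_zero h (diff _ _ _ _ hia (step i b hb))
    (diff _ _ _ _ hia (step i c hc)) (diff _ _ _ _ hia (step i d hd))
  exact sub_eq_zero.1 this

/-! ### Polynomial functions with rational coefficients and generic points -/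

section PolyFun

variable {V : Type*}

/-- A function of the points `q v` that is a polynomial with rational coefficients. -/
def IsPolyFun (f : (V → Fin 3 → ℝ) → ℝ) : Prop :=
  ∃ h : MvPolynomial (V × Fin 3) ℚ, ∀ q, f q = aeval (fun c : V × Fin 3 => q c.1 c.2) h

namespace IsPolyFun

variable {f g : (V → Fin 3 → ℝ) → ℝ}

theorem coord (v : V) (i : Fin 3) : IsPolyFun fun q : V → Fin 3 → ℝ => q v i :=
  ⟨X (v, i), fun q => by simp⟩

theorem const (r : ℚ) : IsPolyFun fun _ : V → Fin 3 → ℝ => (r : ℝ) :=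
  ⟨C r, fun q => by simp⟩

theorem zero : IsPolyFun fun _ : V → Fin 3 → ℝ => (0 : ℝ) := ⟨0, fun q => by simp⟩

theorem add (hf : IsPolyFun f) (hg : IsPolyFun g) : IsPolyFun fun q => f q + g q := by
  obtain ⟨h, hh⟩ := hf
  obtain ⟨k, hk⟩ := hg
  exact ⟨h + k, fun q => by simp [hh, hk]⟩

theorem sub (hf : IsPolyFun f) (hg : IsPolyFun g) : IsPolyFun fun q => f q - g q := by
  obtain ⟨h, hh⟩ := hf
  obtain ⟨k, hk⟩ := hg
  exact ⟨h - k, fun q => by simp [hh, hk]⟩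

theorem mul (hf : IsPolyFun f) (hg : IsPolyFun g) : IsPolyFun fun q => f q * g q := by
  obtain ⟨h, hh⟩ := hf
  obtain ⟨k, hk⟩ := hg
  exact ⟨h * k, fun q => by simp [hh, hk]⟩

theorem sum {ι : Type*} (s : Finset ι) {F : ι → (V → Fin 3 → ℝ) → ℝ}
    (h : ∀ i ∈ s, IsPolyFun (F i)) : IsPolyFun fun q => ∑ i ∈ s, F i q := by
  classical
  induction s using Finset.induction_on with
  | empty => simpa using zero
  | insert a s ha ih =>
    simp only [Finset.sum_insert ha]
    exact (h a (by simp)).add (ih fun i hi => h i (by simp [hi]))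

theorem prod {ι : Type*} (s : Finset ι) {F : ι → (V → Fin 3 → ℝ) → ℝ}
    (h : ∀ i ∈ s, IsPolyFun (F i)) : IsPolyFun fun q => ∏ i ∈ s, F i q := by
  classical
  induction s using Finset.induction_on with
  | empty => simpa using const (V := V) 1
  | insert a s ha ih =>
    simp only [Finset.prod_insert ha]
    exact (h a (by simp)).mul (ih fun i hi => h i (by simp [hi]))

theorem det {ι : Type*} [Fintype ι] [DecidableEq ι] {A : (V → Fin 3 → ℝ) → Matrix ι ι ℝ}
    (h : ∀ i j, IsPolyFun fun q => A q i j) : IsPolyFun fun q => (A q).det := by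
  simp only [Matrix.det_apply']
  exact sum _ fun σ _ => (by simpa using const (V := V) ((Equiv.Perm.sign σ : ℤ) : ℚ) :
    IsPolyFun fun _ : V → Fin 3 → ℝ => (((Equiv.Perm.sign σ : ℤ) : ℤ) : ℝ)).mul
      (prod _ fun i _ => h _ _)

theorem ite {c : Prop} [Decidable c] (hf : IsPolyFun f) (hg : IsPolyFun g) :
    IsPolyFun fun q => if c then f q else g q := by
  split_ifs
  · exact hf
  · exact hg

theorem aeval_point (v : V) (h : MvPolynomial (Fin 3) ℚ) :
    IsPolyFun fun q : V → Fin 3 → ℝ => aeval (q v) h :=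
  ⟨rename (fun i => (v, i)) h, fun q => by rw [aeval_rename]; rfl⟩

end IsPolyFun

/-- A vector valued polynomial function with rational coefficients. -/
def IsPolyVec {ι : Type*} (f : (V → Fin 3 → ℝ) → ι → ℝ) : Prop :=
  ∀ i, IsPolyFun fun q => f q i

namespace IsPolyVec

variable {ι : Type*} {f g : (V → Fin 3 → ℝ) → ι → ℝ}

theorem point (v : V) : IsPolyVec fun q : V → Fin 3 → ℝ => q v := fun i => .coord v i

theorem const (r : ι → ℚ) : IsPolyVec fun (_ : V → Fin 3 → ℝ) i => (r i : ℝ) :=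
  fun i => .const (r i)

theorem add (hf : IsPolyVec f) (hg : IsPolyVec g) : IsPolyVec fun q => f q + g q :=
  fun i => (hf i).add (hg i)

theorem sub (hf : IsPolyVec f) (hg : IsPolyVec g) : IsPolyVec fun q => f q - g q :=
  fun i => (hf i).sub (hg i)

theorem smul {a : (V → Fin 3 → ℝ) → ℝ} (ha : IsPolyFun a) (hf : IsPolyVec f) :
    IsPolyVec fun q => a q • f q :=
  fun i => ha.mul (hf i)

theorem dotProduct [Fintype ι] (hf : IsPolyVec f) (hg : IsPolyVec g) :
    IsPolyFun fun q => f q ⬝ᵥ g q :=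
  IsPolyFun.sum _ fun i _ => (hf i).mul (hg i)

theorem cross {f g : (V → Fin 3 → ℝ) → Fin 3 → ℝ} (hf : IsPolyVec f) (hg : IsPolyVec g) :
    IsPolyVec fun q => f q ⨯₃ g q := by
  intro i
  fin_cases i
  · simpa only [cross_apply_zero, Fin.zero_eta] using
      ((hf 1).mul (hg 2)).sub ((hf 2).mul (hg 1))
  · simpa only [cross_apply_one, Fin.mk_one] using
      ((hf 2).mul (hg 0)).sub ((hf 0).mul (hg 2))
  · simpa only [cross_apply_two, Fin.reduceFinMk] using
      ((hf 0).mul (hg 1)).sub ((hf 1).mul (hg 0))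

theorem triple {f g h : (V → Fin 3 → ℝ) → Fin 3 → ℝ} (hf : IsPolyVec f) (hg : IsPolyVec g)
    (hh : IsPolyVec h) : IsPolyFun fun q => triple (f q) (g q) (h q) :=
  hf.dotProduct (hg.cross hh)

theorem grad (m : MvPolynomial (Fin 3) ℚ) (v : V) :
    IsPolyVec fun q : V → Fin 3 → ℝ => grad m (q v) :=
  fun i => .aeval_point v (pderiv i m)

theorem motion (c : Fin 3 ⊕ Fin 3 → ℚ) {f : (V → Fin 3 → ℝ) → Fin 3 → ℝ} (hf : IsPolyVec f) :
    IsPolyVec fun q => motion (fun i => (c i : ℝ)) (f q) :=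
  ((const fun i => c (Sum.inl i)).cross hf).add (const fun i => c (Sum.inr i))

theorem lineVec {f g : (V → Fin 3 → ℝ) → Fin 3 → ℝ} (hf : IsPolyVec f) (hg : IsPolyVec g) :
    IsPolyVec fun q => lineVec (f q) (g q) := by
  rintro (i | i)
  · exact hf.cross hg i
  · exact hg i

end IsPolyVec

variable {m : MvPolynomial (Fin 3) ℚ} {p q : V → Fin 3 → ℝ}

/-- A polynomial condition that holds for some points of `m = 0` holds at generic points. -/
theorem IsGeneric.ne_zero (hp : IsGeneric m p) {f : (V → Fin 3 → ℝ) → ℝ} (hf : IsPolyFun f)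
    (hq : ∀ v, aeval (q v) m = 0) (h : f q ≠ 0) : f p ≠ 0 := by
  obtain ⟨k, hk⟩ := hf
  rw [hk] at h ⊢
  intro h0
  apply h
  -- Evaluation at `q` kills every generator, so the ideal that contains `k` lies in its kernel.
  have hle : Ideal.span (Set.range fun v : V => rename (fun i : Fin 3 => (v, i)) m) ≤
      RingHom.ker (aeval (fun c : V × Fin 3 => q c.1 c.2) : MvPolynomial (V × Fin 3) ℚ →ₐ[ℚ] ℝ) := by
    rw [Ideal.span_le]
    rintro _ ⟨v, rfl⟩
    change aeval _ (rename _ m) = 0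
    rw [aeval_rename]
    exact hq v
  exact hle (hp k h0)

/-- The Gram determinant turns surjectivity of a rectangular matrix into the nonvanishing of one
polynomial in its entries, which is the kind of condition that passes to generic points. It relies
on `|Aᵀz|² = z · AAᵀz`. -/
theorem mulVec_surjective_iff_det_ne_zero {ι κ : Type*} [Fintype ι] [DecidableEq ι] [Fintype κ]
    (A : Matrix ι κ ℝ) : Function.Surjective A.mulVec ↔ (A * Aᵀ).det ≠ 0 := by
  classical
  constructor
  · intro h
    obtain ⟨B, hB⟩ := Matrix.mulVec_surjective_iff_exists_right_inverse.1 h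
    rw [← isUnit_iff_ne_zero, ← Matrix.isUnit_iff_isUnit_det, ← Matrix.mulVec_injective_iff_isUnit]
    intro x y hxy
    have h0 : (A * Aᵀ) *ᵥ (x - y) = 0 := by rw [mulVec_sub, hxy, sub_self]
    have h1 : (Aᵀ *ᵥ (x - y)) ⬝ᵥ (Aᵀ *ᵥ (x - y)) = 0 := by
      rw [dotProduct_mulVec, vecMul_transpose, mulVec_mulVec, h0, zero_dotProduct]
    have h2 : Aᵀ *ᵥ (x - y) = 0 := dotProduct_self_eq_zero.1 h1
    have h3 : (A * B)ᵀ *ᵥ (x - y) = 0 := by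
      rw [transpose_mul, ← mulVec_mulVec, h2, mulVec_zero]
    rw [hB, transpose_one, one_mulVec] at h3
    exact sub_eq_zero.1 h3
  · intro h
    have hs := Matrix.mulVec_surjective_iff_isUnit.2
      ((Matrix.isUnit_iff_isUnit_det _).2 (isUnit_iff_ne_zero.2 h))
    intro t
    obtain ⟨x, hx⟩ := hs t
    exact ⟨Aᵀ *ᵥ x, by rw [mulVec_mulVec, hx]⟩

/-- Surjectivity of a polynomial family of linear maps passes from any points of `m = 0` to
generic points. -/
theorem IsGeneric.surjective [Fintype V] [DecidableEq V] (hp : IsGeneric m p) {ι : Type*}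
    [Finite ι]
    {φ : (V → Fin 3 → ℝ) → (V → Fin 3 → ℝ) →ₗ[ℝ] (ι → ℝ)}
    (hφ : ∀ (i : ι) (u : V → Fin 3 → ℚ), IsPolyFun fun q => φ q (fun v j => (u v j : ℝ)) i)
    (hq : ∀ v, aeval (q v) m = 0) (h : Function.Surjective (φ q)) :
    Function.Surjective (φ p) := by
  classical
  cases nonempty_fintype ι
  set A : (V → Fin 3 → ℝ) → Matrix ι (V × Fin 3) ℝ := fun q =>
    Matrix.of fun i c => φ q (Pi.single c.1 (Pi.single c.2 1)) i with hA
  have hAφ : ∀ q u, φ q u = A q *ᵥ fun c : V × Fin 3 => u c.1 c.2 := by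
    intro q u
    have hu : u = ∑ c : V × Fin 3, u c.1 c.2 • (Pi.single c.1 (Pi.single c.2 1) : V → Fin 3 → ℝ) := by
      ext v j
      rw [Fintype.sum_prod_type]
      simp only [Finset.sum_apply, Pi.smul_apply, smul_eq_mul]
      rw [Finset.sum_eq_single v]
      · simp [Pi.single_apply]
      · intro w _ hw
        simp [Pi.single_eq_of_ne (Ne.symm hw)]
      · simp
    ext i
    conv_lhs => rw [hu]
    simp [hA, mulVec, dotProduct, map_sum, mul_comm]
  have hsurj : ∀ q, Function.Surjective (φ q) ↔ Function.Surjective (A q).mulVec := by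
    intro q
    constructor
    · intro h t
      obtain ⟨u, hu⟩ := h t
      exact ⟨_, (hAφ q u).symm.trans hu⟩
    · intro h t
      obtain ⟨u, hu⟩ := h t
      exact ⟨fun v j => u (v, j), (hAφ q _).trans hu⟩
  have hpoly : ∀ i c, IsPolyFun fun q => A q i c := by
    intro i c
    have := hφ i (Pi.single c.1 (Pi.single c.2 1))
    have e : (fun v j => ((Pi.single c.1 (Pi.single c.2 1) : V → Fin 3 → ℚ) v j : ℝ)) =
        (Pi.single c.1 (Pi.single c.2 1) : V → Fin 3 → ℝ) := by
      ext v j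
      by_cases hv : v = c.1
      · subst hv
        by_cases hj : j = c.2
        · subst hj; simp
        · simp [hj]
      · simp [hv]
    rw [e] at this
    exact this
  rw [hsurj, mulVec_surjective_iff_det_ne_zero] at h ⊢
  refine hp.ne_zero (f := fun q => (A q * (A q)ᵀ).det) (IsPolyFun.det fun i j => ?_) hq h
  simp only [mul_apply, transpose_apply]
  exact IsPolyFun.sum _ fun c _ => (hpoly i c).mul (hpoly j c)

end PolyFun

/-! ### Kernels of rigidity matrices -/

section Kernel

variable {V : Type*} [DecidableEq V] [Fintype V]

theorem edgeRow_dotProduct (p : V → Fin 3 → ℝ) (a b : V) (x : V × Fin 3 → ℝ) :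
    edgeRow p s(a, b) ⬝ᵥ x =
      ((fun i => x (a, i)) - fun i => x (b, i)) ⬝ᵥ (p a - p b) := by
  simp only [edgeRow, dotProduct, Sym2.lift_mk, Fintype.sum_prod_type, add_mul, ite_mul, zero_mul,
    Finset.sum_add_distrib]
  rw [Finset.sum_eq_single a (by simp +contextual) (by simp),
    Finset.sum_eq_single b (by simp +contextual) (by simp)]
  simp only [if_true, ← Finset.sum_add_distrib, Pi.sub_apply]
  exact Finset.sum_congr rfl fun i _ => by ring

theorem vertexRow_dotProduct (m : MvPolynomial (Fin 3) ℚ) (p : V → Fin 3 → ℝ) (v : V)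
    (x : V × Fin 3 → ℝ) : vertexRow m p v ⬝ᵥ x = (fun i => x (v, i)) ⬝ᵥ grad m (p v) := by
  simp only [vertexRow, dotProduct, Fintype.sum_prod_type, ite_mul, zero_mul]
  rw [Finset.sum_eq_single v (by simp +contextual) (by simp)]
  simp [mul_comm]

theorem mem_ker_rigidityMatrix {m : MvPolynomial (Fin 3) ℚ} {G : SimpleGraph V}
    {p : V → Fin 3 → ℝ} {x : V × Fin 3 → ℝ} :
    x ∈ LinearMap.ker (rigidityMatrix m G p).mulVecLin ↔
      IsInfinitesimalFlex m G p fun v i => x (v, i) := by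
  rw [LinearMap.mem_ker, mulVecLin_apply, funext_iff, Sum.forall, and_comm]
  apply and_congr
  · exact forall_congr' fun v => by
      rw [← vertexRow_dotProduct]
      rfl
  · rw [Subtype.forall, Sym2.forall]
    refine forall_congr' fun a => forall_congr' fun b => forall_congr' fun h => ?_
    change edgeRow p s(a, b) ⬝ᵥ x = 0 ↔ _
    rw [edgeRow_dotProduct, sub_dotProduct, sub_eq_zero]

end Kernel

/-! ### Surfaces of type one -/

section TypeOne

variable {m : MvPolynomial (Fin 3) ℚ} {M : Set (Fin 3 → ℝ)}

theorem isInfinitesimalFlex_top {ι : Type*} {q u : ι → Fin 3 → ℝ} :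
    IsInfinitesimalFlex m ⊤ q u ↔
      (∀ i, u i ⬝ᵥ grad m (q i) = 0) ∧ ∀ i j, (u i - u j) ⬝ᵥ (q i - q j) = 0 := by
  refine and_congr Iff.rfl ⟨fun h i j => ?_, fun h i j _ => ?_⟩
  · by_cases hij : i = j
    · simp [hij]
    · rw [sub_dotProduct, sub_eq_zero]
      exact h i j hij
  · rw [← sub_eq_zero, ← sub_dotProduct]
    exact h i j

theorem HasType.exists_flex (h : HasType m M 1) {ι : Type*} [Fintype ι]
    (hι : 2 ≤ Fintype.card ι) {q : ι → Fin 3 → ℝ} (hq : ∀ i, q i ∈ M) :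
    ∃ u ≠ 0, IsInfinitesimalFlex m ⊤ q u := by
  let e := Fintype.equivFin ι
  have h1 := h.1 _ hι (q ∘ e.symm) fun i => hq _
  obtain ⟨⟨x, hx⟩, hx0⟩ := Module.finrank_pos_iff_exists_ne_zero.1 h1
  rw [mem_ker_rigidityMatrix, isInfinitesimalFlex_top] at hx
  refine ⟨fun v i => x (e v, i), ?_, ?_⟩
  · intro h0
    apply hx0
    ext ⟨v, i⟩
    simpa using congrFun (congrFun h0 (e.symm v)) i
  · rw [isInfinitesimalFlex_top]
    refine ⟨fun v => ?_, fun v w => ?_⟩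
    · simpa using hx.1 (e v)
    · simpa using hx.2 (e v) (e w)

/-- Maximality of the type: since 2 is not a lower bound for the kernel dimensions, some complete
framework has a kernel of dimension at most one. -/
theorem HasType.exists_framework (h : HasType m M 1) :
    ∃ n, 2 ≤ n ∧ ∃ q : Fin n → Fin 3 → ℝ, (∀ i, q i ∈ M) ∧
      ∀ u u', IsInfinitesimalFlex m ⊤ q u → IsInfinitesimalFlex m ⊤ q u' →
        ¬ LinearIndependent ℝ ![u, u'] := by
  have h2 : 2 ∉ {d : ℕ | ∀ n : ℕ, 2 ≤ n → ∀ p : Fin n → Fin 3 → ℝ, (∀ i, p i ∈ M) →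
    d ≤ Module.finrank ℝ
      (LinearMap.ker (rigidityMatrix m (⊤ : SimpleGraph (Fin n)) p).mulVecLin)} := by
    intro h2
    have := h.2 h2
    omega
  simp only [Set.mem_ofPred_eq, not_forall] at h2
  obtain ⟨n, hn, q, hq, hd⟩ := h2
  refine ⟨n, hn, q, hq, fun u u' hu hu' hli => hd ?_⟩
  let K := LinearMap.ker (rigidityMatrix m (⊤ : SimpleGraph (Fin n)) q).mulVecLin
  let U : K := ⟨fun c => u c.1 c.2, mem_ker_rigidityMatrix.2 hu⟩
  let U' : K := ⟨fun c => u' c.1 c.2, mem_ker_rigidityMatrix.2 hu'⟩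
  have hli' : LinearIndependent ℝ ![U, U'] := by
    rw [LinearIndependent.pair_iff] at hli ⊢
    intro s t hst
    apply hli s t
    ext v i
    exact congrFun (congrArg Subtype.val hst) (v, i)
  simpa using hli'.fintype_card_le_finrank

theorem hasStrictFDerivAt_aeval (h : MvPolynomial (Fin 3) ℚ) (a : Fin 3 → ℝ) :
    HasStrictFDerivAt (fun x : Fin 3 → ℝ => aeval x h)
      (∑ i, aeval a (pderiv i h) • ContinuousLinearMap.proj (R := ℝ) (φ := fun _ : Fin 3 => ℝ) i)
      a := by
  induction h using MvPolynomial.induction_on with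
  | C r => simpa using hasStrictFDerivAt_const (𝕜 := ℝ) (algebraMap ℚ ℝ r) a
  | add f g hf hg =>
    simp only [map_add, add_smul, Finset.sum_add_distrib]
    exact hf.add hg
  | mul_X f j hf =>
    have hX : HasStrictFDerivAt (fun x : Fin 3 → ℝ => x j)
        (ContinuousLinearMap.proj (R := ℝ) (φ := fun _ : Fin 3 => ℝ) j) a :=
      (ContinuousLinearMap.proj (R := ℝ) (φ := fun _ : Fin 3 => ℝ) j).hasStrictFDerivAt
    have e : (∑ i, aeval a (pderiv i (f * X j)) •
          ContinuousLinearMap.proj (R := ℝ) (φ := fun _ : Fin 3 => ℝ) i) =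
        aeval a f • ContinuousLinearMap.proj (R := ℝ) (φ := fun _ : Fin 3 => ℝ) j +
          a j • ∑ i, aeval a (pderiv i f) •
            ContinuousLinearMap.proj (R := ℝ) (φ := fun _ : Fin 3 => ℝ) i := by
      simp only [Derivation.leibniz, pderiv_X, map_add, smul_eq_mul, map_mul, aeval_X, add_smul,
        Finset.sum_add_distrib, Finset.smul_sum, smul_smul]
      congr 1
      rw [Finset.sum_eq_single j]
      · simp
      · intro i _ hi
        simp [Pi.single_eq_of_ne hi.symm]
      · simp
    rw [e]
    simp only [map_mul, aeval_X]
    exact hf.mul hX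

/-- Lagrange multipliers: the derivative of a function that is constant on the surface is a
multiple of the normal vector. -/
theorem IsIrreducibleSurface.exists_eq_smul_grad (hM : IsIrreducibleSurface m M)
    {a : Fin 3 → ℝ} (ha : a ∈ M) {F : (Fin 3 → ℝ) → ℝ} {k : Fin 3 → ℝ}
    {F' : (Fin 3 → ℝ) →L[ℝ] ℝ} (hF : HasStrictFDerivAt F F' a) (hk : ∀ τ, F' τ = k ⬝ᵥ τ)
    (hc : ∀ x ∈ M, F x = F a) : ∃ l : ℝ, k = l • grad m a := by
  obtain ⟨-, U, hU, rfl⟩ := hM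
  have hd := hasStrictFDerivAt_aeval m a
  -- `M` need not contain every zero of `m`, but near `a` it does, which suffices for a local
  -- extremum on the zero set.
  have hopen : ∀ᶠ x in nhds a, x ∈ U ∧ grad m x ≠ 0 := by
    refine Filter.Eventually.and (hU.mem_nhds ha.1) ?_
    have hcont : ContinuousAt (grad m) a := by
      rw [continuousAt_pi]
      intro i
      exact (hasStrictFDerivAt_aeval (pderiv i m) a).continuousAt
    exact hcont.eventually_ne ha.2.2
  have hext : IsLocalExtrOn F {x | aeval x m = aeval a m} a := by
    refine Or.inl ?_
    filter_upwards [mem_nhdsWithin_of_mem_nhds hopen, self_mem_nhdsWithin] with x hx hx0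
    refine (hc x ⟨hx.1, ?_, hx.2⟩).ge
    rw [show aeval x m = aeval a m from hx0]
    exact ha.2.1
  obtain ⟨α, β, hne, h0⟩ := hext.exists_multipliers_of_hasStrictFDerivAt_1d hd hF
  have hcoord : ∀ i, α * grad m a i + β * k i = 0 := by
    intro i
    have := congrArg (fun L : (Fin 3 → ℝ) →L[ℝ] ℝ => L (Pi.single i 1)) h0
    simpa [hk, grad, Pi.single_apply] using this
  -- If `β = 0`, the multiplier relation would say `∇m(a) = 0`.
  have hβ : β ≠ 0 := by
    rintro rfl
    apply ha.2.2
    have hα : α ≠ 0 := fun h => hne (by simp [h])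
    ext i
    simpa [hα] using hcoord i
  refine ⟨-(α / β), ?_⟩
  ext i
  have := hcoord i
  simp only [Pi.smul_apply, smul_eq_mul]
  field_simp
  linarith

end TypeOne

/-! ### Tangential rigid motions and normal lines on a surface of type one -/

section TypeOne

variable {m : MvPolynomial (Fin 3) ℚ} {M : Set (Fin 3 → ℝ)}

theorem IsIrreducibleSurface.aeval_eq_zero (hM : IsIrreducibleSurface m M) {x : Fin 3 → ℝ}
    (hx : x ∈ M) : aeval x m = 0 := by
  obtain ⟨-, U, -, rfl⟩ := hM
  exact hx.2.1

theorem IsIrreducibleSurface.grad_ne_zero (hM : IsIrreducibleSurface m M) {x : Fin 3 → ℝ}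
    (hx : x ∈ M) : grad m x ≠ 0 := by
  obtain ⟨-, U, -, rfl⟩ := hM
  exact hx.2.2

/-- A set of vectors in `ℝ³` with vanishing triple products is orthogonal to a nonzero vector. -/
theorem exists_normal_of_triple_eq_zero {s : Set (Fin 3 → ℝ)}
    (h : ∀ x ∈ s, ∀ y ∈ s, ∀ z ∈ s, triple x y z = 0) :
    ∃ ν : Fin 3 → ℝ, ν ≠ 0 ∧ ∀ x ∈ s, ν ⬝ᵥ x = 0 := by
  have hlt : Submodule.span ℝ s < ⊤ := by
    rw [lt_top_iff_ne_top]
    intro htop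
    obtain ⟨b, hbs, hspan, hli⟩ := exists_linearIndependent ℝ s
    have : Fintype b := hli.setFinite.fintype
    let B : Module.Basis b ℝ (Fin 3 → ℝ) := Module.Basis.mk hli (by
      rw [Subtype.range_coe, hspan, htop])
    have hcard : Fintype.card b = 3 := by
      rw [← Module.finrank_eq_card_basis B]; simp
    let e := Fintype.equivFinOfCardEq hcard
    have hli3 : LinearIndependent ℝ fun i : Fin 3 => (e.symm i).1 :=
      hli.comp _ e.symm.injective
    have h0 := h _ (hbs (e.symm 0).2) _ (hbs (e.symm 1).2) _ (hbs (e.symm 2).2)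
    rw [triple, triple_product_eq_det] at h0
    have hrows : LinearIndependent ℝ
        (Matrix.of ![(e.symm 0).1, (e.symm 1).1, (e.symm 2).1]).row := by
      have he : (Matrix.of ![(e.symm 0).1, (e.symm 1).1, (e.symm 2).1]).row =
          fun i : Fin 3 => (e.symm i).1 := by
        ext i j; fin_cases i <;> rfl
      rw [he]
      exact hli3
    have hunit := Matrix.linearIndependent_rows_iff_isUnit.1 hrows
    rw [Matrix.isUnit_iff_isUnit_det] at hunit
    exact not_isUnit_zero (h0 ▸ hunit)
  obtain ⟨f, hf, hle⟩ := Submodule.exists_le_ker_of_lt_top _ hlt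
  have hfx : ∀ x, f x = (fun i => f (Pi.single i 1)) ⬝ᵥ x := by
    intro x
    conv_lhs => rw [pi_eq_sum_univ' x]
    simp [dotProduct, map_sum, mul_comm]
  refine ⟨fun i => f (Pi.single i 1), ?_, fun x hx => ?_⟩
  · intro h0
    apply hf
    ext x
    simpa using congrFun h0 x
  · rw [← hfx]
    exact hle (Submodule.subset_span hx)

/-- If `M` lay in a plane, that plane would be the tangent plane everywhere, and its translations
would give two independent flexes of every complete framework. -/
theorem HasType.exists_not_coplanar (hM : IsIrreducibleSurface m M) (ht : HasType m M 1) :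
    ∃ a ∈ M, ∃ b ∈ M, ∃ c ∈ M, ∃ d ∈ M, triple (b - a) (c - a) (d - a) ≠ 0 := by
  by_contra! hcop
  obtain ⟨n, hn, q, hq, hli⟩ := ht.exists_framework
  obtain ⟨ν, hν, hplane⟩ := exists_normal_of_triple_eq_zero
    (s := (fun x => x - q ⟨0, by omega⟩) '' M) (by
      rintro _ ⟨x, hx, rfl⟩ _ ⟨y, hy, rfl⟩ _ ⟨z, hz, rfl⟩
      exact hcop _ (hq _) x hx y hy z hz)
  have hgrad : ∀ x ∈ M, ∃ l : ℝ, ν = l • grad m x := by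
    intro x hx
    refine hM.exists_eq_smul_grad hx (F := fun y => ν ⬝ᵥ y)
      (F' := LinearMap.toContinuousLinearMap (dotProductBilin ℝ ℝ ν))
      (LinearMap.toContinuousLinearMap (dotProductBilin ℝ ℝ ν)).hasStrictFDerivAt (fun τ => rfl) ?_
    intro y hy
    have h1 := hplane _ ⟨x, hx, rfl⟩
    have h2 := hplane _ ⟨y, hy, rfl⟩
    rw [dotProduct_sub, sub_eq_zero] at h1 h2
    rw [h1, h2]
  have hflex : ∀ s : Fin 3 → ℝ, s ⬝ᵥ ν = 0 → IsInfinitesimalFlex m ⊤ q fun _ => s := by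
    intro s hs
    rw [isInfinitesimalFlex_top]
    refine ⟨fun i => ?_, fun i j => by simp⟩
    obtain ⟨l, hl⟩ := hgrad _ (hq i)
    have hl0 : l ≠ 0 := by
      rintro rfl
      exact hν (by simpa using hl)
    rw [hl, dotProduct_smul, smul_eq_mul] at hs
    exact (mul_eq_zero.1 hs).resolve_left hl0
  obtain ⟨s, hs, hsν, -⟩ := exists_ne_zero_dotProduct_eq_zero ν 0
  have hcν : (s ⨯₃ ν) ⬝ᵥ ν = 0 := by rw [dotProduct_comm]; exact dot_cross_self _ _
  refine hli _ _ (hflex s hsν) (hflex _ hcν) ?_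
  rw [LinearIndependent.pair_iff]
  intro α β hαβ
  have h1 : α • s + β • (s ⨯₃ ν) = 0 := congrFun hαβ ⟨0, by omega⟩
  have hss : s ⬝ᵥ s ≠ 0 := fun h => hs (dotProduct_self_eq_zero.1 h)
  have hνν : ν ⬝ᵥ ν ≠ 0 := fun h => hν (dotProduct_self_eq_zero.1 h)
  have hα : α = 0 := by
    have := congrArg (fun y => s ⬝ᵥ y) h1
    simpa [hss] using this
  refine ⟨hα, ?_⟩
  have := congrArg (fun y => (s ⨯₃ ν) ⬝ᵥ y) h1
  simp only [hα, zero_smul, zero_add, dotProduct_smul, cross_dot_cross, hsν, dotProduct_zero,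
    smul_eq_mul, dotProduct_comm ν s, mul_zero, sub_zero] at this
  simpa [hss, hνν] using this

/-- The infinitesimal rigid motions of `ℝ³` that are tangential along `M`. -/
def slides (m : MvPolynomial (Fin 3) ℚ) (M : Set (Fin 3 → ℝ)) :
    Submodule ℝ (Fin 3 ⊕ Fin 3 → ℝ) where
  carrier := {c | ∀ x ∈ M, motion c x ⬝ᵥ grad m x = 0}
  add_mem' hc hd x hx := by rw [motion_add, add_dotProduct, hc x hx, hd x hx, add_zero]
  zero_mem' x hx := by rw [motion_zero, zero_dotProduct]
  smul_mem' a c hc x hx := by rw [motion_smul, smul_dotProduct, hc x hx, smul_zero]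

theorem isInfinitesimalFlex_motion {c : Fin 3 ⊕ Fin 3 → ℝ} {ι : Type*} {q : ι → Fin 3 → ℝ}
    (hc : ∀ i, motion c (q i) ⬝ᵥ grad m (q i) = 0) :
    IsInfinitesimalFlex m ⊤ q fun i => motion c (q i) :=
  isInfinitesimalFlex_top.2 ⟨hc, fun _ _ => motion_sub_dotProduct _ _ _⟩

/-- The slides are the orthogonal complement of all normal line vectors in `ℝ⁶`. A basis of the span
chosen among these vectors tests membership at finitely many points, and rank-nullity gives the
dimension. -/
theorem exists_lineVec_basis (m : MvPolynomial (Fin 3) ℚ) (M : Set (Fin 3 → ℝ)) :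
    ∃ (k : ℕ) (x : Fin k → Fin 3 → ℝ), (∀ i, x i ∈ M) ∧
      LinearIndependent ℝ (fun i => lineVec (x i) (grad m (x i))) ∧
      (∀ c, (∀ i, motion c (x i) ⬝ᵥ grad m (x i) = 0) → c ∈ slides m M) ∧
      Module.finrank ℝ (slides m M) + k = 6 := by
  set L : (Fin 3 → ℝ) → (Fin 3 ⊕ Fin 3 → ℝ) := fun x => lineVec x (grad m x) with hL
  obtain ⟨b, hbs, hspan, hli⟩ := exists_linearIndependent ℝ (L '' M)
  have : Fintype b := hli.setFinite.fintype
  let e := Fintype.equivFin b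
  have hx : ∀ i, ∃ x ∈ M, L x = (e.symm i).1 := fun i => hbs (e.symm i).2
  choose x hxM hxL using hx
  have hli' : LinearIndependent ℝ (fun i => lineVec (x i) (grad m (x i))) := by
    have : (fun i => lineVec (x i) (grad m (x i))) = fun i => (e.symm i).1 := funext hxL
    rw [this]
    exact hli.comp _ e.symm.injective
  have hW : ∀ c, (∀ i, motion c (x i) ⬝ᵥ grad m (x i) = 0) → c ∈ slides m M := by
    intro c hc
    have hle : L '' M ⊆ LinearMap.ker (dotProductBilin ℝ ℝ c) := by
      refine Submodule.span_le.1 (hspan ▸ Submodule.span_le.2 fun y hy => ?_)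
      have hy' : y = L (x (e ⟨y, hy⟩)) := by rw [hxL]; simp
      change c ⬝ᵥ y = 0
      rw [hy', hL, dotProduct_lineVec, hc]
    intro y hy
    rw [← dotProduct_lineVec]
    exact hle ⟨y, hy, rfl⟩
  refine ⟨_, x, hxM, hli', hW, ?_⟩
  set B : Matrix (Fin (Fintype.card b)) (Fin 3 ⊕ Fin 3) ℝ :=
    Matrix.of fun i => lineVec (x i) (grad m (x i)) with hB
  have hrank : B.rank = Fintype.card b := by
    have : LinearIndependent ℝ B.row := hli'
    rw [this.rank_matrix, Fintype.card_fin]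
  have hker : LinearMap.ker B.mulVecLin = slides m M := by
    ext c
    rw [LinearMap.mem_ker, mulVecLin_apply, funext_iff]
    have hBc : ∀ i, (B *ᵥ c) i = motion c (x i) ⬝ᵥ grad m (x i) := by
      intro i
      rw [← dotProduct_lineVec, dotProduct_comm]
      rfl
    simp only [hBc, Pi.zero_apply]
    exact ⟨hW c, fun hc i => hc _ (hxM i)⟩
  have := LinearMap.finrank_range_add_finrank_ker B.mulVecLin
  rw [hker] at this
  change B.rank + _ = _ at this
  rw [hrank] at this
  simp only [Module.finrank_fintype_fun_eq_card, Fintype.card_sum, Fintype.card_fin] at this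
  omega

/-- The complete framework on four non-coplanar points together with finitely many points that
detect slides has a nonzero flex. The four points make the flex a rigid motion, and the others make
that motion a slide. -/
theorem HasType.slides_ne_bot (hM : IsIrreducibleSurface m M) (ht : HasType m M 1) :
    slides m M ≠ ⊥ := by
  obtain ⟨a, ha, b, hb, c, hc, d, hd, hne⟩ := ht.exists_not_coplanar hM
  obtain ⟨k, x, hxM, -, hW, -⟩ := exists_lineVec_basis m M
  obtain ⟨u, hu0, hu⟩ := ht.exists_flex (ι := Fin k ⊕ Fin 4) (q := Sum.elim x ![a, b, c, d])
    (by simp) (by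
      rintro (i | i)
      · exact hxM i
      · fin_cases i <;> assumption)
  rw [isInfinitesimalFlex_top] at hu
  obtain ⟨s, hs⟩ := exists_motion_of_complete hu.2 (a := Sum.inr 0) (b := Sum.inr 1)
    (c := Sum.inr 2) (d := Sum.inr 3) hne
  rw [Submodule.ne_bot_iff]
  refine ⟨s, hW s fun i => ?_, ?_⟩
  · have := hu.1 (Sum.inl i)
    rwa [hs] at this
  · rintro rfl
    apply hu0
    ext1 i
    rw [hs, motion_zero, Pi.zero_apply]

/-- On the framework with kernel of dimension at most one, two independent slides restrict to
dependent flexes. Some nonzero combination `k` therefore fixes all points of the framework, so they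
lie on its rotation axis. Each of these collinear points can then move alone, tangentially and at
right angles to the axis, which gives two independent flexes after all. -/
theorem HasType.not_linearIndependent_slides (ht : HasType m M 1)
    {c c' : Fin 3 ⊕ Fin 3 → ℝ} (hc : c ∈ slides m M) (hc' : c' ∈ slides m M) :
    ¬ LinearIndependent ℝ ![c, c'] := by
  intro hli
  obtain ⟨n, hn, q, hq, hq2⟩ := ht.exists_framework
  have hdep := hq2 _ _ (isInfinitesimalFlex_motion fun i => hc _ (hq i))
    (isInfinitesimalFlex_motion fun i => hc' _ (hq i))
  rw [LinearIndependent.pair_iff] at hli hdep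
  push Not at hdep
  obtain ⟨α, β, h0, hne⟩ := hdep
  set k := α • c + β • c' with hk
  have hk0 : k ≠ 0 := fun h => by
    obtain ⟨h1, h2⟩ := hli α β h
    exact hne h1 h2
  have hkq : ∀ i, motion k (q i) = 0 := by
    intro i
    rw [hk, motion_add, motion_smul, motion_smul]
    exact congrFun h0 i
  set ω := k ∘ Sum.inl with hω
  have hω0 : ω ≠ 0 := by
    intro h
    apply hk0
    have ht := hkq ⟨0, by omega⟩
    rw [motion, ← hω, h] at ht
    ext (i | i)
    · exact congrFun h i
    · simpa using congrFun ht i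
  have hcross : ∀ i j, ω ⨯₃ (q i - q j) = 0 := by
    intro i j
    have h1 := hkq i
    have h2 := hkq j
    rw [motion, ← hω] at h1 h2
    rw [map_sub, eq_neg_of_add_eq_zero_left h1, eq_neg_of_add_eq_zero_left h2, sub_self]
  -- The differences are parallel to `ω`; Lagrange's identity extracts orthogonality without
  -- introducing the factor.
  have hperp : ∀ s : Fin 3 → ℝ, s ⬝ᵥ ω = 0 → ∀ i j, s ⬝ᵥ (q i - q j) = 0 := by
    intro s hs i j
    have h1 := cross_dot_cross ω s ω (q i - q j)
    rw [hcross, dotProduct_zero, hs, mul_zero, sub_zero] at h1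
    exact (mul_eq_zero.1 h1.symm).resolve_left fun h => hω0 (dotProduct_self_eq_zero.1 h)
  choose s hs0 hsω hsn using fun i => exists_ne_zero_dotProduct_eq_zero ω (grad m (q i))
  have hflex : ∀ i, IsInfinitesimalFlex m ⊤ q (Pi.single i (s i)) := by
    intro i
    rw [isInfinitesimalFlex_top]
    have hzero : ∀ j, (Pi.single i (s i) : Fin n → Fin 3 → ℝ) j ⬝ᵥ ω = 0 := by
      intro j
      by_cases hj : j = i
      · subst hj; simp [hsω]
      · simp [hj]
    refine ⟨fun j => ?_, fun j l => ?_⟩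
    · by_cases hj : j = i
      · subst hj; simp [hsn]
      · simp [hj]
    · rw [sub_dotProduct, hperp _ (hzero j), hperp _ (hzero l), sub_zero]
  refine hq2 _ _ (hflex ⟨0, by omega⟩) (hflex ⟨1, by omega⟩) ?_
  rw [LinearIndependent.pair_iff]
  intro γ δ h
  have h0 := congrFun h ⟨0, by omega⟩
  have h1 := congrFun h ⟨1, by omega⟩
  constructor
  · simpa [Pi.single_apply, hs0] using h0
  · simpa [Pi.single_apply, hs0] using h1

/-- The tangential rigid motions of a surface of type one form a line, and the normal lines at
suitable five points of the surface are linearly independent. -/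
theorem HasType.finrank_slides (hM : IsIrreducibleSurface m M) (ht : HasType m M 1) :
    Module.finrank ℝ (slides m M) = 1 := by
  apply le_antisymm
  · by_contra! h
    obtain ⟨f, hf⟩ := exists_linearIndependent_of_le_finrank (R := ℝ) (M := slides m M) h
    refine ht.not_linearIndependent_slides (f 0).2 (f 1).2 ?_
    have he : ![(f 0).1, (f 1).1] = (slides m M).subtype ∘ f := by
      ext i j
      fin_cases i <;> rfl
    rw [he]
    exact hf.map' (slides m M).subtype (Submodule.ker_subtype _)
  · exact Submodule.one_le_finrank_iff.2 (ht.slides_ne_bot hM)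

theorem HasType.exists_five_points (hM : IsIrreducibleSurface m M) (ht : HasType m M 1) :
    ∃ x : Fin 5 → Fin 3 → ℝ, (∀ i, x i ∈ M) ∧
      LinearIndependent ℝ (fun i => lineVec (x i) (grad m (x i))) := by
  obtain ⟨k, x, hxM, hli, -, hk⟩ := exists_lineVec_basis m M
  rw [ht.finrank_slides hM] at hk
  obtain rfl : k = 5 := by omega
  exact ⟨x, hxM, hli⟩

end TypeOne

/-! ### Linear independence at generic points, and rationality of the tangential motions -/

section Rational

variable {V κ : Type*} {m : MvPolynomial (Fin 3) ℚ}

/-- Renaming the variables back along a left inverse of `v` undoes the renaming along `v` and maps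
generators of the ideal to generators. -/
theorem IsGeneric.comp_injective [Nonempty κ] {p : V → Fin 3 → ℝ} (hp : IsGeneric m p) {v : κ → V}
    (hv : Function.Injective v) : IsGeneric m (p ∘ v) := by
  intro h h0
  have h1 := hp (rename (Prod.map v id) h) (by rw [aeval_rename]; exact h0)
  have h2 := Ideal.mem_map_of_mem
    (rename (Prod.map (Function.invFun v) id) : MvPolynomial (V × Fin 3) ℚ →ₐ[ℚ] _) h1
  rw [rename_rename, Prod.map_comp_map, Function.invFun_comp hv, Function.comp_id, Prod.map_id,
    rename_id_apply, Ideal.map_span] at h2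
  refine Ideal.span_le.2 ?_ h2
  rintro _ ⟨_, ⟨w, rfl⟩, rfl⟩
  refine Ideal.subset_span ⟨Function.invFun v w, ?_⟩
  simp only [rename_rename]
  rfl

variable [Fintype κ]

/-- The tensor product of linear functionals on polynomials in separate sets of variables. -/
def tensorFunctional (l : κ → MvPolynomial (Fin 3) ℚ →ₗ[ℚ] ℚ) :
    MvPolynomial (κ × Fin 3) ℚ →ₗ[ℚ] ℚ :=
  (basisMonomials (κ × Fin 3) ℚ).constr ℚ fun s =>
    ∏ v, l v (monomial (Finsupp.equivFunOnFinite.symm fun j => s (v, j)) 1)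

theorem prod_rename_monomial (s : κ → Fin 3 →₀ ℕ) :
    ∏ v, rename (fun j : Fin 3 => (v, j)) (monomial (s v) (1 : ℚ)) =
      monomial (Finsupp.equivFunOnFinite.symm fun c : κ × Fin 3 => s c.1 c.2) 1 := by
  classical
  simp only [rename_monomial]
  rw [← monomial_sum_one]
  refine congrArg (fun s => monomial s (1 : ℚ)) (Finsupp.ext ?_)
  rintro ⟨w, j⟩
  rw [Finsupp.finsetSum_apply, Finset.sum_eq_single w]
  · exact Finsupp.mapDomain_apply (fun a b h => (Prod.ext_iff.1 h).2) (s w) j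
  · intro v _ hv
    exact Finsupp.mapDomain_of_notMem_range _ _ fun ⟨k, hk⟩ => hv (Prod.ext_iff.1 hk).1
  · simp

/-- Both sides are multilinear in `g`, so monomials suffice, and there the equation is the
definition. -/
theorem tensorFunctional_prod (l : κ → MvPolynomial (Fin 3) ℚ →ₗ[ℚ] ℚ)
    (g : κ → MvPolynomial (Fin 3) ℚ) :
    tensorFunctional l (∏ v, rename (fun j : Fin 3 => (v, j)) (g v)) = ∏ v, l v (g v) := by
  classical
  have key : (tensorFunctional l).compMultilinearMap
      ((MultilinearMap.mkPiAlgebra ℚ κ (MvPolynomial (κ × Fin 3) ℚ)).compLinearMap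
        fun v => (rename (fun j : Fin 3 => (v, j)) : _ →ₐ[ℚ] _).toLinearMap) =
      (MultilinearMap.mkPiAlgebra ℚ κ ℚ).compLinearMap l := by
    refine Module.Basis.ext_multilinear (fun _ => basisMonomials (Fin 3) ℚ) fun s => ?_
    simp only [coe_basisMonomials, LinearMap.compMultilinearMap_apply,
      MultilinearMap.compLinearMap_apply, MultilinearMap.mkPiAlgebra_apply, AlgHom.toLinearMap_apply]
    rw [prod_rename_monomial]
    have := (basisMonomials (κ × Fin 3) ℚ).constr_basis ℚ (fun s =>
      ∏ v, l v (monomial (Finsupp.equivFunOnFinite.symm fun j => s (v, j)) 1))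
      (Finsupp.equivFunOnFinite.symm fun c : κ × Fin 3 => s c.1 c.2)
    rw [coe_basisMonomials] at this
    refine this.trans (Finset.prod_congr rfl fun v _ => ?_)
    exact congrArg (fun t => l v (monomial t (1 : ℚ))) (Finsupp.ext fun j => rfl)
  exact congrArg (fun F => F g) key

/-- A monomial times `m(X_v)` is a product over the vertices whose factor at `v` is a multiple of
`m`, so `l v` annihilates it. -/
theorem tensorFunctional_eq_zero {l : κ → MvPolynomial (Fin 3) ℚ →ₗ[ℚ] ℚ}
    (hl : ∀ v g, l v (g * m) = 0) {h : MvPolynomial (κ × Fin 3) ℚ}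
    (hh : h ∈ Ideal.span (Set.range fun v : κ => rename (fun i : Fin 3 => (v, i)) m)) :
    tensorFunctional l h = 0 := by
  classical
  suffices H : ∀ g, tensorFunctional l (g * h) = 0 by simpa using H 1
  induction hh using Submodule.span_induction with
  | mem x hx =>
    obtain ⟨v, rfl⟩ := hx
    have key : tensorFunctional l ∘ₗ
        LinearMap.mulRight ℚ (rename (fun i : Fin 3 => (v, i)) m) = 0 := by
      refine (basisMonomials (κ × Fin 3) ℚ).ext fun s => ?_
      simp only [coe_basisMonomials, LinearMap.comp_apply, LinearMap.mulRight_apply,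
        LinearMap.zero_apply]
      have hs : s = Finsupp.equivFunOnFinite.symm fun c : κ × Fin 3 =>
          (Finsupp.equivFunOnFinite.symm fun j => s (c.1, j) : Fin 3 →₀ ℕ) c.2 := by
        ext c; rfl
      have hm : rename (fun i : Fin 3 => (v, i)) m =
          ∏ w, rename (fun i : Fin 3 => (w, i))
            ((Pi.mulSingle v m : κ → MvPolynomial (Fin 3) ℚ) w) := by
        rw [Finset.prod_eq_single v]
        · simp
        · intro w _ hw
          simp [Pi.mulSingle_eq_of_ne hw]
        · simp
      rw [hs, ← prod_rename_monomial (fun w => Finsupp.equivFunOnFinite.symm fun j => s (w, j)), hm,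
        ← Finset.prod_mul_distrib]
      simp only [← map_mul]
      rw [tensorFunctional_prod]
      refine Finset.prod_eq_zero (Finset.mem_univ v) ?_
      rw [Pi.mulSingle_eq_same]
      exact hl _ _
    exact fun g => congrArg (fun F => F g) key
  | zero => simp
  | add x y _ _ hx hy => intro g; rw [mul_add, map_add, hx, hy, add_zero]
  | smul a x _ hx => intro g; rw [smul_eq_mul, ← mul_assoc, hx]

/-- Polynomials that are linearly independent modulo `m` are linearly independent at generic
points. -/
theorem IsGeneric.det_ne_zero [DecidableEq κ] {p : κ → Fin 3 → ℝ} (hp : IsGeneric m p)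
    {f : κ → MvPolynomial (Fin 3) ℚ}
    (hf : ∀ c : κ → ℚ, ∑ j, c j • f j ∈ Ideal.span {m} → c = 0) :
    (Matrix.of fun i j => aeval (p i) (f j)).det ≠ 0 := by
  intro h0
  let π := Ideal.Quotient.mkₐ ℚ (Ideal.span {m})
  have hker : LinearMap.ker (Fintype.linearCombination ℚ fun j => π (f j)) = ⊥ := by
    rw [LinearMap.ker_eq_bot']
    intro c hc
    apply hf
    rw [← Ideal.Quotient.eq_zero_iff_mem]
    have : π (∑ j, c j • f j) = 0 := by
      simpa [Fintype.linearCombination_apply] using hc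
    exact this
  -- The classes of the `f j` modulo `m` are independent over ℚ, so there are dual functionals `l i`
  -- that vanish on multiples of `m`.
  obtain ⟨g, hg⟩ := LinearMap.exists_leftInverse_of_injective _ hker
  let l : κ → MvPolynomial (Fin 3) ℚ →ₗ[ℚ] ℚ := fun i =>
    LinearMap.proj i ∘ₗ g ∘ₗ π.toLinearMap
  have hl : ∀ i j, l i (f j) = (1 : Matrix κ κ ℚ) i j := by
    intro i j
    have := congrArg (fun F => F (Pi.single j 1)) hg
    simp only [LinearMap.comp_apply, LinearMap.id_apply, Fintype.linearCombination_apply_single,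
      one_smul] at this
    have h1 : l i (f j) = g (π (f j)) i := rfl
    rw [h1, this, Matrix.one_apply, Pi.single_apply]
  have hlm : ∀ v g, l v (g * m) = 0 := by
    intro v h
    have : π (h * m) = 0 :=
      Ideal.Quotient.eq_zero_iff_mem.2 (Ideal.mul_mem_left _ _ (Ideal.subset_span rfl))
    change g (π (h * m)) v = 0
    rw [this, map_zero, Pi.zero_apply]
  set D : MvPolynomial (κ × Fin 3) ℚ :=
    (Matrix.of fun i j => rename (fun k : Fin 3 => (i, k)) (f j)).det with hD
  have hD0 : aeval (fun c : κ × Fin 3 => p c.1 c.2) D = 0 := by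
    rw [hD, AlgHom.map_det, ← h0]
    congr 1
    ext i j
    simp only [AlgHom.mapMatrix_apply, Matrix.map_apply, Matrix.of_apply, aeval_rename]
    rfl
  have h1 := tensorFunctional_eq_zero hlm (hp D hD0)
  -- Row `i` of `D` uses only the variables of the point `i`. Hence the functional acts on each
  -- Leibniz term as the product of the `l i`, and its value on `D` is the determinant of `(l i (f
  -- j))`, the identity matrix.
  rw [hD, ← Matrix.det_transpose, Matrix.det_apply, map_sum] at h1
  have h2 : (1 : Matrix κ κ ℚ).det = 0 := by
    rw [← h1, ← Matrix.det_transpose, Matrix.det_apply]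
    refine Finset.sum_congr rfl fun σ _ => ?_
    simp only [Units.smul_def, map_zsmul, Matrix.transpose_apply, Matrix.of_apply]
    rw [tensorFunctional_prod l fun i => f (σ i)]
    simp only [hl]
  simp at h2

/-- With at least six generic points, the tangential rigid motions of a surface of type one are
spanned by a rational one. -/
theorem HasType.exists_rational_slide [Fintype V] (hV : 6 ≤ Fintype.card V)
    {M : Set (Fin 3 → ℝ)} (hM : IsIrreducibleSurface m M) (ht : HasType m M 1)
    {p : V → Fin 3 → ℝ} (hp : ∀ v, p v ∈ M) (hgen : IsGeneric m p) :
    ∃ c : Fin 3 ⊕ Fin 3 → ℚ, c ≠ 0 ∧ (fun i => (c i : ℝ)) ∈ slides m M := by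
  classical
  obtain ⟨v⟩ : Nonempty (Fin 3 ⊕ Fin 3 ↪ V) :=
    Function.Embedding.nonempty_of_card_le (by simpa using hV)
  let x : Fin 3 → MvPolynomial (Fin 3) ℚ := X
  let g : Fin 3 → MvPolynomial (Fin 3) ℚ := fun i => pderiv i m
  let f : Fin 3 ⊕ Fin 3 → MvPolynomial (Fin 3) ℚ := Sum.elim (x ⨯₃ g) g
  have hfy : ∀ (y : Fin 3 → ℝ) j, aeval y (f j) = lineVec y (grad m y) j := by
    rintro y (j | j)
    · fin_cases j <;> simp [f, x, g, lineVec, cross_apply, grad]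
    · rfl
  -- A rational combination of the six coordinates of the normal line that is divisible by `m`
  -- vanishes on `M`, so its coefficients form a slide. Without rational slides the coordinates are
  -- independent modulo `m`, and the matrix of six generic normal lines is invertible; but a nonzero
  -- real slide lies in its kernel.
  by_contra! hno
  have hdet := (hgen.comp_injective v.injective).det_ne_zero (f := f) (by
    intro c hc
    by_contra hc0
    refine hno c hc0 fun y hy => ?_
    obtain ⟨a, ha⟩ := Ideal.mem_span_singleton.1 hc
    have := congrArg (aeval y) ha
    rw [map_mul, hM.aeval_eq_zero hy, zero_mul, map_sum] at this
    rw [← dotProduct_lineVec, ← this]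
    simp [dotProduct, hfy, Algebra.smul_def])
  obtain ⟨c, hc, hc0⟩ := Submodule.exists_mem_ne_zero_of_ne_bot (ht.slides_ne_bot hM)
  apply hc0
  have hinj := Matrix.mulVec_injective_iff_isUnit.2
    ((Matrix.isUnit_iff_isUnit_det _).2 (isUnit_iff_ne_zero.2 hdet))
  apply hinj
  rw [mulVec_zero]
  ext i
  have := hc _ (hp (v i))
  rw [← dotProduct_lineVec, dotProduct_comm] at this
  rw [Pi.zero_apply, ← this]
  simp only [mulVec, Matrix.of_apply, hfy, dotProduct, Function.comp_apply]

end Rational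

/-! ### Sparse sets of edges and loops -/

section Sparse

variable {V : Type*} [DecidableEq V]

/-- The edges and loops of `E` inside `S`. -/
def edgesIn (E : Finset (Sym2 V)) (S : Finset V) : Finset (Sym2 V) := E.filter (· ∈ S.sym2)

theorem mem_edgesIn {E : Finset (Sym2 V)} {S : Finset V} {e : Sym2 V} :
    e ∈ edgesIn E S ↔ e ∈ E ∧ e ∈ S.sym2 := Finset.mem_filter

/-- `(2, 1)`-sparsity of a set of edges and loops. -/
def LoopSparse (E : Finset (Sym2 V)) : Prop :=
  ∀ S : Finset V, S.Nonempty → (edgesIn E S).card + 1 ≤ 2 * S.card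

/-- `(2, 1)`-tightness of a set of vertices. -/
def LoopTight (E : Finset (Sym2 V)) (S : Finset V) : Prop :=
  (edgesIn E S).card + 1 = 2 * S.card

theorem LoopSparse.mono {E F : Finset (Sym2 V)} (h : LoopSparse F) (hEF : E ⊆ F) :
    LoopSparse E := fun S hS =>
  (Nat.add_le_add_right (Finset.card_le_card (Finset.filter_subset_filter _ hEF)) 1).trans (h S hS)

theorem edgesIn_union_subset (E : Finset (Sym2 V)) (S T : Finset V) :
    edgesIn E S ∪ edgesIn E T ⊆ edgesIn E (S ∪ T) :=
  Finset.union_subset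
    (Finset.monotone_filter_right _ fun _ _ h => Finset.sym2_mono Finset.subset_union_left h)
    (Finset.monotone_filter_right _ fun _ _ h => Finset.sym2_mono Finset.subset_union_right h)

/-- A set that violates the count only after `e` is added must contain `e` and have had no slack
before. -/
theorem exists_tight_of_not_sparse_insert {E : Finset (Sym2 V)} (h : LoopSparse E) {e : Sym2 V}
    (hne : ¬ LoopSparse (insert e E)) : ∃ T, LoopTight E T ∧ e ∈ T.sym2 := by
  unfold LoopSparse at hne
  push Not at hne
  obtain ⟨T, hT, hlt⟩ := hne
  have h1 := h T hT
  by_cases he : e ∈ T.sym2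
  · refine ⟨T, ?_, he⟩
    have h2 : (edgesIn (insert e E) T).card ≤ (edgesIn E T).card + 1 := by
      unfold edgesIn
      rw [Finset.filter_insert, if_pos he]
      exact Finset.card_insert_le _ _
    unfold LoopTight
    omega
  · have h2 : edgesIn (insert e E) T = edgesIn E T := by
      unfold edgesIn
      rw [Finset.filter_insert, if_neg he]
    rw [h2] at hlt
    omega

/-- Edge counts are supermodular and vertex counts modular, so sparsity of the intersection and of
the union leaves no slack in either. -/
theorem LoopTight.union {E : Finset (Sym2 V)} (h : LoopSparse E) {S T : Finset V}
    (hS : LoopTight E S) (hT : LoopTight E T) (hST : (S ∩ T).Nonempty) : LoopTight E (S ∪ T) := by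
  have h1 := h _ hST
  have h2 := h (S ∪ T) (hST.mono (Finset.inter_subset_left.trans Finset.subset_union_left))
  have h3 := Finset.card_union_add_card_inter S T
  have h4 := Finset.card_union_add_card_inter (edgesIn E S) (edgesIn E T)
  have h5 := Finset.card_le_card (edgesIn_union_subset E S T)
  have h6 : (edgesIn E S ∩ edgesIn E T).card ≤ (edgesIn E (S ∩ T)).card := by
    refine Finset.card_le_card fun e he => ?_
    rw [Finset.mem_inter, mem_edgesIn, mem_edgesIn] at he
    rw [mem_edgesIn, Finset.mem_sym2_iff]
    refine ⟨he.1.1, fun a ha => ?_⟩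
    rw [Finset.mem_inter]
    exact ⟨Finset.mem_sym2_iff.1 he.1.2 a ha, Finset.mem_sym2_iff.1 he.2.2 a ha⟩
  unfold LoopTight at *
  omega

/-- For disjoint `S` and `T` the two counts together fall short of `2|S ∪ T|` by two, and the edge
`ab` between them supplies the missing one. -/
theorem LoopTight.union_of_mem {E : Finset (Sym2 V)} (h : LoopSparse E) {S T : Finset V}
    (hS : LoopTight E S) (hT : LoopTight E T) {a b : V} (ha : a ∈ S) (hb : b ∈ T)
    (hab : s(a, b) ∈ E) : LoopTight E (S ∪ T) := by
  by_cases hST : (S ∩ T).Nonempty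
  · exact hS.union h hT hST
  rw [Finset.not_nonempty_iff_eq_empty] at hST
  have h2 := h (S ∪ T) ⟨a, Finset.mem_union_left _ ha⟩
  have h3 := Finset.card_union_add_card_inter S T
  rw [hST, Finset.card_empty] at h3
  have hnot : ∀ x, x ∈ S → x ∈ T → False := fun x h1 h2 => by
    have := Finset.mem_inter.2 ⟨h1, h2⟩
    rw [hST] at this
    simp at this
  have hdisj : Disjoint (edgesIn E S) (edgesIn E T) := by
    rw [Finset.disjoint_left]
    intro e he he'
    rw [mem_edgesIn, Finset.mem_sym2_iff] at he he'
    induction e with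
    | _ x y => exact hnot x (he.2 x (by simp)) (he'.2 x (by simp))
  have hne : s(a, b) ∉ edgesIn E S ∪ edgesIn E T := by
    rw [Finset.mem_union, mem_edgesIn, mem_edgesIn, Finset.mk_mem_sym2_iff, Finset.mk_mem_sym2_iff]
    rintro (⟨-, -, h⟩ | ⟨-, h, -⟩)
    · exact hnot b h hb
    · exact hnot a ha h
  have h5 : (insert s(a, b) (edgesIn E S ∪ edgesIn E T)).card ≤ (edgesIn E (S ∪ T)).card := by
    refine Finset.card_le_card (Finset.insert_subset ?_ (edgesIn_union_subset E S T))
    rw [mem_edgesIn, Finset.mk_mem_sym2_iff]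
    exact ⟨hab, Finset.mem_union_left _ ha, Finset.mem_union_right _ hb⟩
  rw [Finset.card_insert_of_notMem hne, Finset.card_union_of_disjoint hdisj] at h5
  unfold LoopTight at *
  omega

theorem loopTight_singleton {E : Finset (Sym2 V)} {a : V} (ha : s(a, a) ∈ E) :
    LoopTight E {a} := by
  have : edgesIn E {a} = {s(a, a)} := by
    ext e
    rw [mem_edgesIn, Finset.sym2_singleton, Finset.mem_singleton, Finset.mem_singleton]
    constructor
    · exact fun h => h.2
    · intro h
      exact ⟨h ▸ ha, h⟩
  simp [LoopTight, this]

/-- The vertices joined to `v`, including `v` itself if there is a loop at `v`. -/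
def nbrs [Fintype V] (E : Finset (Sym2 V)) (v : V) : Finset V :=
  Finset.univ.filter fun o => s(v, o) ∈ E

theorem mem_nbrs [Fintype V] {E : Finset (Sym2 V)} {v o : V} :
    o ∈ nbrs E v ↔ s(v, o) ∈ E := by simp [nbrs]

theorem card_nbrs [Fintype V] (E : Finset (Sym2 V)) (v : V) :
    (nbrs E v).card = (E.filter (v ∈ ·)).card := by
  refine Finset.card_bij (fun o _ => s(v, o)) ?_ ?_ ?_
  · intro o ho
    simpa using mem_nbrs.1 ho
  · intro o _ o' _ h
    exact Sym2.congr_right.1 h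
  · intro e he
    rw [Finset.mem_filter] at he
    obtain ⟨o, rfl⟩ := Sym2.mem_iff_exists.1 he.2
    exact ⟨o, mem_nbrs.2 he.1, rfl⟩

/-- A vertex with at least three neighbours cannot have them all inside a tight set of the
remaining graph. -/
theorem LoopSparse.not_nbrs_subset [Fintype V] {E : Finset (Sym2 V)} (h : LoopSparse E) {v : V}
    (hv : 3 ≤ (nbrs E v).card) {T : Finset V} (hT : LoopTight (E.filter (v ∉ ·)) T) :
    ¬ nbrs E v ⊆ insert v T := by
  intro hsub
  -- The `2|T| - 1` edges in `T` and at least three at `v` would make `2|T| + 2` edges on at most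
  -- `|T| + 1` vertices.
  have h1 := h (insert v T) (Finset.insert_nonempty _ _)
  have h2 := Finset.card_insert_le v T
  rw [card_nbrs] at hv
  have hdisj : Disjoint (edgesIn (E.filter (v ∉ ·)) T) (E.filter (v ∈ ·)) := by
    rw [Finset.disjoint_left]
    intro e he he'
    rw [mem_edgesIn, Finset.mem_filter] at he
    exact he.1.2 (Finset.mem_filter.1 he').2
  have h3 : (edgesIn (E.filter (v ∉ ·)) T ∪ E.filter (v ∈ ·)).card ≤
      (edgesIn E (insert v T)).card := by
    refine Finset.card_le_card (Finset.union_subset ?_ ?_)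
    · intro e he
      rw [mem_edgesIn, Finset.mem_filter] at he
      rw [mem_edgesIn]
      exact ⟨he.1.1, Finset.sym2_mono (Finset.subset_insert _ _) he.2⟩
    · intro e he
      rw [Finset.mem_filter] at he
      obtain ⟨o, rfl⟩ := Sym2.mem_iff_exists.1 he.2
      rw [mem_edgesIn, Finset.mk_mem_sym2_iff]
      exact ⟨he.1, Finset.mem_insert_self _ _, hsub (mem_nbrs.2 he.1)⟩
  rw [Finset.card_union_of_disjoint hdisj] at h3
  unfold LoopTight at hT
  omega

/-- A nonempty sparse graph has a vertex of degree at most three, a loop counting once. -/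
theorem LoopSparse.exists_card_nbrs_le_three [Fintype V] {E : Finset (Sym2 V)}
    (h : LoopSparse E) (hE : E.Nonempty) :
    ∃ v, (nbrs E v).Nonempty ∧ (nbrs E v).card ≤ 3 := by
  by_contra! hno
  set S : Finset V := Finset.univ.filter fun v => (nbrs E v).Nonempty with hS
  have hSne : S.Nonempty := by
    obtain ⟨e, he⟩ := hE
    induction e with
    | _ x y => exact ⟨x, by rw [hS, Finset.mem_filter]; exact ⟨Finset.mem_univ _, y, mem_nbrs.2 he⟩⟩
  have h1 := h S hSne
  have hES : edgesIn E S = E := by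
    refine Finset.filter_true_of_mem fun e he => ?_
    rw [Finset.mem_sym2_iff]
    intro a ha
    obtain ⟨o, rfl⟩ := Sym2.mem_iff_exists.1 ha
    rw [hS, Finset.mem_filter]
    exact ⟨Finset.mem_univ _, o, mem_nbrs.2 he⟩
  rw [hES] at h1
  -- Double counting: all degrees at least four would give `4|S| ≤ 2|E| ≤ 4|S| - 2`.
  have h2 : ∑ v ∈ S, (nbrs E v).card ≤ ∑ e ∈ E, 2 := by
    simp only [card_nbrs]
    refine (Finset.sum_card_bipartiteAbove_eq_sum_card_bipartiteBelow (fun v e => v ∈ e)).le.trans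
      (Finset.sum_le_sum fun e _ => ?_)
    induction e with
    | _ x y =>
      refine (Finset.card_le_card (t := {x, y}) fun v hv => ?_).trans Finset.card_le_two
      simpa [Finset.bipartiteBelow] using (Finset.mem_filter.1 hv).2
  have h3 : ∑ v ∈ S, 4 ≤ ∑ v ∈ S, (nbrs E v).card :=
    Finset.sum_le_sum fun v hv => hno v (Finset.mem_filter.1 hv).2
  simp only [Finset.sum_const, smul_eq_mul] at h2 h3
  omega

end Sparse

/-! ### Nondegeneracy of generic points -/

section Nondegenerate

variable {m : MvPolynomial (Fin 3) ℚ} {M : Set (Fin 3 → ℝ)}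

theorem eq_zero_of_forall_dotProduct_sub {M : Set (Fin 3 → ℝ)}
    (h : ∃ a ∈ M, ∃ b ∈ M, ∃ c ∈ M, ∃ d ∈ M, triple (b - a) (c - a) (d - a) ≠ 0)
    {s : Fin 3 → ℝ} (hs : ∀ x ∈ M, ∀ y ∈ M, s ⬝ᵥ (x - y) = 0) : s = 0 := by
  obtain ⟨a, ha, b, hb, c, hc, d, hd, hne⟩ := h
  exact eq_zero_of_triple_ne_zero hne (hs b hb a ha) (hs c hc a ha) (hs d hd a ha)

/-- A velocity field orthogonal to all chords vanishes on the non-coplanar set `M`. Fixed points of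
a nonzero motion are at most a line, which is again coplanar. -/
theorem exists_motion_dotProduct_ne_zero
    (h : ∃ a ∈ M, ∃ b ∈ M, ∃ c ∈ M, ∃ d ∈ M, triple (b - a) (c - a) (d - a) ≠ 0)
    {k : Fin 3 ⊕ Fin 3 → ℝ} (hk : k ≠ 0) :
    ∃ x ∈ M, ∃ y ∈ M, motion k x ⬝ᵥ (x - y) ≠ 0 := by
  by_contra! h0
  have hzero : ∀ x ∈ M, motion k x = 0 := by
    intro x hx
    refine eq_zero_of_forall_dotProduct_sub h fun y hy z hz => ?_
    have h1 := h0 x hx y hy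
    have h2 := h0 x hx z hz
    have : y - z = (x - z) - (x - y) := by abel
    rw [this, dotProduct_sub, h1, h2, sub_zero]
  have hcross : ∀ x ∈ M, ∀ y ∈ M, (k ∘ Sum.inl) ⨯₃ (x - y) = 0 := by
    intro x hx y hy
    have h1 := hzero x hx
    have h2 := hzero y hy
    rw [motion] at h1 h2
    rw [map_sub, eq_neg_of_add_eq_zero_left h1, eq_neg_of_add_eq_zero_left h2, sub_self]
  have hω : k ∘ Sum.inl = 0 := by
    by_contra hω
    obtain ⟨s, hs0, hs, -⟩ := exists_ne_zero_dotProduct_eq_zero (k ∘ Sum.inl) 0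
    refine hs0 (eq_zero_of_forall_dotProduct_sub h fun x hx y hy => ?_)
    have h1 := cross_dot_cross (k ∘ Sum.inl) s (k ∘ Sum.inl) (x - y)
    rw [hcross x hx y hy, dotProduct_zero, hs, mul_zero, sub_zero] at h1
    exact (mul_eq_zero.1 h1.symm).resolve_left fun h => hω (dotProduct_self_eq_zero.1 h)
  obtain ⟨a, ha, -⟩ := h
  have := hzero a ha
  rw [motion, hω] at this
  apply hk
  ext (i | i)
  · exact congrFun hω i
  · simpa using congrFun this i

/-- By Cramer's rule the normal at `a` is a combination of three independent chords with these
triple products as coefficients; they cannot all vanish. -/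
theorem IsIrreducibleSurface.exists_triple_grad_ne_zero (hM : IsIrreducibleSurface m M)
    (h : ∃ a ∈ M, ∃ b ∈ M, ∃ c ∈ M, ∃ d ∈ M, triple (b - a) (c - a) (d - a) ≠ 0) :
    ∃ x ∈ M, ∃ y ∈ M, ∃ z ∈ M, triple (x - y) (x - z) (grad m x) ≠ 0 := by
  by_contra! h0
  obtain ⟨a, ha, b, hb, c, hc, d, hd, hne⟩ := h
  apply hM.grad_ne_zero ha
  have h1 := h0 a ha b hb c hc
  have h2 := h0 a ha c hc d hd
  have h3 := h0 a ha d hd b hb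
  generalize grad m a = n at *
  have key : triple (b - a) (c - a) (d - a) • n = triple (a - c) (a - d) n • (b - a) +
      triple (a - d) (a - b) n • (c - a) + triple (a - b) (a - c) n • (d - a) := by
    ext i
    fin_cases i <;>
    · simp only [triple, dotProduct_three, cross_apply_zero, cross_apply_one, cross_apply_two,
        Pi.add_apply, Pi.sub_apply, Pi.smul_apply, smul_eq_mul, Fin.zero_eta, Fin.mk_one,
        Fin.reduceFinMk]
      ring
  rw [h1, h2, h3] at key
  simpa [hne] using key

variable {V : Type*} [DecidableEq V] {p : V → Fin 3 → ℝ}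

/-- Generic points `p v` on a surface of type one. -/
structure GenericOn (m : MvPolynomial (Fin 3) ℚ) (M : Set (Fin 3 → ℝ)) (p : V → Fin 3 → ℝ) :
    Prop where
  surface : IsIrreducibleSurface m M
  type_one : HasType m M 1
  mem : ∀ v, p v ∈ M
  generic : IsGeneric m p

/-- Moving only `a`, `b`, `c` to suitable points of `M` gives one configuration with a nonzero
value, which is enough for generic points. The nondegeneracy statements below follow the same
pattern. -/
theorem GenericOn.triple_grad_ne_zero (h : GenericOn m M p) {a b c : V} (hab : a ≠ b)
    (hac : a ≠ c) (hbc : b ≠ c) :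
    triple (p a - p b) (p a - p c) (grad m (p a)) ≠ 0 := by
  obtain ⟨x, hx, y, hy, z, hz, hne⟩ :=
    h.surface.exists_triple_grad_ne_zero (h.type_one.exists_not_coplanar h.surface)
  refine h.generic.ne_zero (f := fun q => triple (q a - q b) (q a - q c) (grad m (q a)))
    (q := Function.update (Function.update (Function.update p c z) b y) a x)
    (((IsPolyVec.point a).sub (.point b)).triple ((IsPolyVec.point a).sub (.point c)) (.grad m a))
    (fun v => h.surface.aeval_eq_zero ?_) ?_
  · simp only [Function.update_apply]
    split_ifs <;> simp_all [h.mem]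
  · simpa [Function.update_apply, hab, hac, hbc, hab.symm, hac.symm, hbc.symm] using hne

theorem GenericOn.cross_grad_ne_zero (h : GenericOn m M p) {a b : V} (hab : a ≠ b) :
    (p a - p b) ⨯₃ (grad m (p a)) ≠ 0 := by
  obtain ⟨x, hx, y, hy, z, hz, hne⟩ :=
    h.surface.exists_triple_grad_ne_zero (h.type_one.exists_not_coplanar h.surface)
  have hne' : ((x - y) ⨯₃ (grad m x)) ⬝ᵥ ((x - y) ⨯₃ (grad m x)) ≠ 0 := by
    intro h0
    apply hne
    rw [triple, triple_product_permutation, ← neg_cross, dotProduct_self_eq_zero.1 h0]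
    simp
  intro h0
  -- The squared length makes the vector condition a single scalar polynomial.
  refine h.generic.ne_zero
    (f := fun q => ((q a - q b) ⨯₃ grad m (q a)) ⬝ᵥ ((q a - q b) ⨯₃ grad m (q a)))
    (q := Function.update (Function.update p b y) a x)
    ((((IsPolyVec.point a).sub (.point b)).cross (.grad m a)).dotProduct
      (((IsPolyVec.point a).sub (.point b)).cross (.grad m a)))
    (fun v => h.surface.aeval_eq_zero ?_) ?_ ?_
  · simp only [Function.update_apply]
    split_ifs <;> simp_all [h.mem]
  · simpa [Function.update_apply, hab, hab.symm] using hne'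
  · simp only [h0, zero_dotProduct]

theorem GenericOn.triple_ne_zero (h : GenericOn m M p) {a b c d : V} (hab : a ≠ b)
    (hac : a ≠ c) (had : a ≠ d) (hbc : b ≠ c) (hbd : b ≠ d) (hcd : c ≠ d) :
    triple (p b - p a) (p c - p a) (p d - p a) ≠ 0 := by
  obtain ⟨x, hx, y, hy, z, hz, w, hw, hne⟩ := h.type_one.exists_not_coplanar h.surface
  refine h.generic.ne_zero (f := fun q => triple (q b - q a) (q c - q a) (q d - q a))
    (q := Function.update (Function.update (Function.update (Function.update p d w) c z) b y) a x)
    (((IsPolyVec.point b).sub (.point a)).triple ((IsPolyVec.point c).sub (.point a))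
      ((IsPolyVec.point d).sub (.point a)))
    (fun v => h.surface.aeval_eq_zero ?_) ?_
  · simp only [Function.update_apply]
    split_ifs <;> simp_all [h.mem]
  · simpa [Function.update_apply, hab, hac, hbc, had, hbd, hcd, hab.symm, hac.symm, hbc.symm,
      had.symm, hbd.symm, hcd.symm] using hne

theorem GenericOn.motion_dotProduct_ne_zero (h : GenericOn m M p) {c : Fin 3 ⊕ Fin 3 → ℚ} (hc : c ≠ 0)
    {a b : V} (hab : a ≠ b) : motion (fun i => (c i : ℝ)) (p a) ⬝ᵥ (p a - p b) ≠ 0 := by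
  obtain ⟨x, hx, y, hy, hne⟩ := exists_motion_dotProduct_ne_zero
    (h.type_one.exists_not_coplanar h.surface)
    (k := fun i => (c i : ℝ)) (fun h0 => hc (by ext i; simpa using congrFun h0 i))
  refine h.generic.ne_zero (f := fun q => motion (fun i => (c i : ℝ)) (q a) ⬝ᵥ (q a - q b))
    (q := Function.update (Function.update p b y) a x)
    ((IsPolyVec.motion c (.point a)).dotProduct ((IsPolyVec.point a).sub (.point b)))
    (fun v => h.surface.aeval_eq_zero ?_) ?_
  · simp only [Function.update_apply]
    split_ifs <;> simp_all [h.mem]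
  · simpa [Function.update_apply, hab, hab.symm] using hne

theorem GenericOn.motion_ne_zero (h : GenericOn m M p) {c : Fin 3 ⊕ Fin 3 → ℚ} (hc : c ≠ 0)
    (a : V) :
    motion (fun i => (c i : ℝ)) (p a) ≠ 0 := by
  obtain ⟨x, hx, y, hy, hne⟩ := exists_motion_dotProduct_ne_zero
    (h.type_one.exists_not_coplanar h.surface)
    (k := fun i => (c i : ℝ)) (fun h0 => hc (by ext i; simpa using congrFun h0 i))
  have hx0 : motion (fun i => (c i : ℝ)) x ≠ 0 := fun h => hne (by rw [h, zero_dotProduct])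
  intro h0
  refine h.generic.ne_zero
    (f := fun q => motion (fun i => (c i : ℝ)) (q a) ⬝ᵥ motion (fun i => (c i : ℝ)) (q a))
    (q := Function.update p a x)
    ((IsPolyVec.motion c (.point a)).dotProduct (IsPolyVec.motion c (.point a)))
    (fun v => h.surface.aeval_eq_zero ?_) ?_ ?_
  · simp only [Function.update_apply]
    split_ifs <;> simp_all [h.mem]
  · simpa using fun h => hx0 (dotProduct_self_eq_zero.1 h)
  · simp [h0]

/-- The lines normal to the surface at up to five generic points are linearly independent. -/
theorem GenericOn.linearIndependent_lineVec (h : GenericOn m M p) {k : ℕ} (hk : k ≤ 5)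
    {v : Fin k → V} (hv : Function.Injective v) :
    LinearIndependent ℝ fun i => lineVec (p (v i)) (grad m (p (v i))) := by
  obtain ⟨x, hx, hli⟩ := h.type_one.exists_five_points h.surface
  have hli' := hli.comp (Fin.castLE hk) (Fin.castLE_injective hk)
  set A : (V → Fin 3 → ℝ) → Matrix (Fin k) (Fin 3 ⊕ Fin 3) ℝ := fun q =>
    Matrix.of fun i => lineVec (q (v i)) (grad m (q (v i))) with hA
  have hiff : ∀ q, LinearIndependent ℝ (A q).row ↔ (A q * (A q)ᵀ).det ≠ 0 := by
    intro q
    rw [← isUnit_iff_ne_zero, ← Matrix.isUnit_iff_isUnit_det,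
      ← Matrix.linearIndependent_rows_iff_isUnit, linearIndependent_iff_card_eq_finrank_span,
      linearIndependent_iff_card_eq_finrank_span]
    have h1 := Matrix.rank_eq_finrank_span_row (A q)
    have h2 := Matrix.rank_eq_finrank_span_row (A q * (A q)ᵀ)
    rw [Matrix.rank_self_mul_transpose] at h2
    unfold Set.finrank
    rw [← h1, ← h2]
  change LinearIndependent ℝ (A p).row
  rw [hiff]
  set q : V → Fin 3 → ℝ := fun w =>
    if hi : ∃ i, v i = w then x (Fin.castLE hk hi.choose) else p w with hq
  have hqv : ∀ i, q (v i) = x (Fin.castLE hk i) := by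
    intro i
    have hj : ∃ j, v j = v i := ⟨i, rfl⟩
    rw [hq]
    simp only [hj, dif_pos]
    rw [hv hj.choose_spec]
  refine h.generic.ne_zero (f := fun q => (A q * (A q)ᵀ).det) (q := q) (IsPolyFun.det fun i j => ?_)
    (fun w => h.surface.aeval_eq_zero ?_) ?_
  · simp only [mul_apply, transpose_apply]
    exact IsPolyFun.sum _ fun l _ =>
      (IsPolyVec.lineVec (.point (v i)) (.grad m (v i)) l).mul
        (IsPolyVec.lineVec (.point (v j)) (.grad m (v j)) l)
  · simp only [hq]
    split_ifs
    · exact hx _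
    · exact h.mem w
  · rw [← hiff]
    have : (A q).row = (fun i => lineVec (x i) (grad m (x i))) ∘ Fin.castLE hk := by
      ext1 i
      change lineVec (q (v i)) (grad m (q (v i))) = _
      rw [hqv]
      rfl
    rw [this]
    exact hli'

end Nondegenerate

/-! ### Constraints of edges and loops -/

section Constraints

variable {V : Type*} [DecidableEq V] (m : MvPolynomial (Fin 3) ℚ) (c : Fin 3 ⊕ Fin 3 → ℚ)

/-- The tangential direction orthogonal to the velocity of the rigid motion `c`. -/
def loopVec (x : Fin 3 → ℝ) : Fin 3 → ℝ := grad m x ⨯₃ motion (fun i => (c i : ℝ)) x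

/-- The linear form of an edge or a loop: an edge `ab` with `a ≠ b` constrains the velocities to
preserve the length of `ab`, a loop at `a` constrains the velocity of `a` to be a multiple of the
velocity of the rigid motion `c`. -/
def pairForm (p u : V → Fin 3 → ℝ) (e : Sym2 V) : ℝ :=
  Sym2.lift ⟨fun a b => (u a - u b) ⬝ᵥ (p a - p b) + if a = b then u a ⬝ᵥ loopVec m c (p a) else 0,
    fun a b => by
      by_cases h : a = b
      · subst h; rfl
      · simp only [if_neg h, if_neg (Ne.symm h), sub_dotProduct, dotProduct_sub]; ring⟩ e

theorem pairForm_mk (p u : V → Fin 3 → ℝ) (a b : V) :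
    pairForm m c p u s(a, b) =
      (u a - u b) ⬝ᵥ (p a - p b) + if a = b then u a ⬝ᵥ loopVec m c (p a) else 0 := rfl

theorem pairForm_of_ne (p u : V → Fin 3 → ℝ) {a b : V} (h : a ≠ b) :
    pairForm m c p u s(a, b) = (u a - u b) ⬝ᵥ (p a - p b) := by
  rw [pairForm_mk, if_neg h, add_zero]

theorem pairForm_loop (p u : V → Fin 3 → ℝ) (a : V) :
    pairForm m c p u s(a, a) = u a ⬝ᵥ loopVec m c (p a) := by
  rw [pairForm_mk, if_pos rfl, sub_self, zero_dotProduct, zero_add]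

theorem pairForm_add (p u u' : V → Fin 3 → ℝ) (e : Sym2 V) :
    pairForm m c p (u + u') e = pairForm m c p u e + pairForm m c p u' e := by
  induction e with
  | _ a b =>
    simp only [pairForm_mk, Pi.add_apply, sub_dotProduct, add_dotProduct]
    split_ifs <;> ring

theorem pairForm_smul (p u : V → Fin 3 → ℝ) (r : ℝ) (e : Sym2 V) :
    pairForm m c p (r • u) e = r * pairForm m c p u e := by
  induction e with
  | _ a b =>
    simp only [pairForm_mk, Pi.smul_apply, sub_dotProduct, smul_dotProduct, smul_eq_mul]
    split_ifs <;> ring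

theorem pairForm_congr {p u p' u' : V → Fin 3 → ℝ} {e : Sym2 V} (hp : ∀ a ∈ e, p a = p' a)
    (hu : ∀ a ∈ e, u a = u' a) : pairForm m c p u e = pairForm m c p' u' e := by
  induction e with
  | _ a b =>
    simp only [pairForm_mk, hp a (by simp), hp b (by simp), hu a (by simp), hu b (by simp)]

theorem pairForm_update_of_notMem {p u : V → Fin 3 → ℝ} {v : V} {e : Sym2 V} (he : v ∉ e)
    (x z : Fin 3 → ℝ) :
    pairForm m c (Function.update p v x) (Function.update u v z) e = pairForm m c p u e := by
  refine pairForm_congr m c (fun a ha => ?_) fun a ha => ?_ <;>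
  · rw [Function.update_of_ne]
    rintro rfl
    exact he ha

/-- The velocities `u` satisfy the constraints of `E` and are tangential. -/
def IsLoopFlex (E : Finset (Sym2 V)) (p u : V → Fin 3 → ℝ) : Prop :=
  (∀ e ∈ E, pairForm m c p u e = 0) ∧ ∀ v, u v ⬝ᵥ grad m (p v) = 0

/-- The constraints of `E` and of tangentiality are linearly independent: they may be given
arbitrary right hand sides. -/
def LoopIndependent (E : Finset (Sym2 V)) (p : V → Fin 3 → ℝ) : Prop :=
  ∀ (t : Sym2 V → ℝ) (s : V → ℝ), ∃ u : V → Fin 3 → ℝ,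
    (∀ e ∈ E, pairForm m c p u e = t e) ∧ ∀ v, u v ⬝ᵥ grad m (p v) = s v

variable {m c}

theorem IsLoopFlex.zero (E : Finset (Sym2 V)) (p : V → Fin 3 → ℝ) : IsLoopFlex m c E p 0 :=
  ⟨fun e _ => by simpa using pairForm_smul m c p 0 0 e, fun v => by simp⟩

theorem loopIndependent_empty {p : V → Fin 3 → ℝ} (hp : ∀ v, grad m (p v) ≠ 0) :
    LoopIndependent m c ∅ p := fun t s =>
  ⟨fun v => (s v / (grad m (p v) ⬝ᵥ grad m (p v))) • grad m (p v), by simp, fun v => by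
    have : grad m (p v) ⬝ᵥ grad m (p v) ≠ 0 := fun h => hp v (dotProduct_self_eq_zero.1 h)
    rw [smul_dotProduct, smul_eq_mul, div_mul_cancel₀ _ this]⟩

/-- The constraint of the edge or loop `vo` on the velocity of `v`, for `v` placed at `x`. -/
def nbrVec (m : MvPolynomial (Fin 3) ℚ) (c : Fin 3 ⊕ Fin 3 → ℚ) (p : V → Fin 3 → ℝ) (v o : V)
    (x : Fin 3 → ℝ) : Fin 3 → ℝ :=
  if o = v then loopVec m c x else x - p o

/-- The value prescribed by the velocities of the other vertices for the constraint of `vo` on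
the velocity of `v`, for `v` placed at `x`. -/
def nbrVal (p u : V → Fin 3 → ℝ) (v o : V) (x : Fin 3 → ℝ) : ℝ :=
  if o = v then 0 else u o ⬝ᵥ (x - p o)

theorem pairForm_update (p u : V → Fin 3 → ℝ) (v o : V) (x z : Fin 3 → ℝ) :
    pairForm m c (Function.update p v x) (Function.update u v z) s(v, o) =
      z ⬝ᵥ nbrVec m c p v o x - nbrVal p u v o x := by
  by_cases h : o = v
  · subst h
    rw [pairForm_loop, Function.update_self, Function.update_self, nbrVec, nbrVal, if_pos rfl,
      if_pos rfl, sub_zero]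
  · rw [pairForm_of_ne m c _ _ (Ne.symm h), Function.update_self, Function.update_self,
      Function.update_of_ne h, Function.update_of_ne h, nbrVec, nbrVal, if_neg h, if_neg h,
      sub_dotProduct]

theorem nbrVal_add_smul (p u u' : V → Fin 3 → ℝ) (l : ℝ) (v o : V) (x : Fin 3 → ℝ) :
    nbrVal p (u + l • u') v o x = nbrVal p u v o x + l * nbrVal p u' v o x := by
  unfold nbrVal
  split_ifs
  · simp
  · simp only [Pi.add_apply, Pi.smul_apply, add_dotProduct, smul_dotProduct, smul_eq_mul]

/-- When `v` is placed on its neighbour `a`, the constraint of the edge `vo` turns into that of the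
edge `ao`, and a loop at `v` turns into a loop at `a`. -/
theorem pairForm_update_of_ne {p u : V → Fin 3 → ℝ} {v a o : V} (hao : a ≠ o) :
    pairForm m c p u s(a, if o = v then a else o) =
      u a ⬝ᵥ nbrVec m c p v o (p a) - nbrVal p u v o (p a) := by
  by_cases h : o = v
  · rw [if_pos h, pairForm_loop, nbrVec, nbrVal, if_pos h, if_pos h, sub_zero]
  · rw [if_neg h, pairForm_of_ne m c _ _ hao, nbrVec, nbrVal, if_neg h, if_neg h, sub_dotProduct]

/-- Independence extends over a vertex `v` placed at `x` if, up to adding a multiple of a flex of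
the rest, the velocity of `v` can be chosen to attain any right hand sides. -/
theorem LoopIndependent.extend {E : Finset (Sym2 V)} {v : V} {p u₀ : V → Fin 3 → ℝ}
    (h : LoopIndependent m c (E.filter (v ∉ ·)) p) (hu₀ : IsLoopFlex m c (E.filter (v ∉ ·)) p u₀)
    (x : Fin 3 → ℝ)
    (hx : ∀ (u : V → Fin 3 → ℝ) (t : V → ℝ) (σ : ℝ), ∃ (z : Fin 3 → ℝ) (l : ℝ),
      (∀ o, s(v, o) ∈ E →
        z ⬝ᵥ nbrVec m c p v o x - (nbrVal p u v o x + l * nbrVal p u₀ v o x) = t o) ∧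
      z ⬝ᵥ grad m x = σ) :
    LoopIndependent m c E (Function.update p v x) := by
  intro t s
  obtain ⟨u, hu, hus⟩ := h t s
  obtain ⟨z, l, hz, hzs⟩ := hx u (fun o => t s(v, o)) (s v)
  refine ⟨Function.update (u + l • u₀) v z, fun e he => ?_, fun w => ?_⟩
  · by_cases hve : v ∈ e
    · obtain ⟨o, rfl⟩ := Sym2.mem_iff_exists.1 hve
      rw [pairForm_update, nbrVal_add_smul]
      exact hz o he
    · have he' : e ∈ E.filter (v ∉ ·) := Finset.mem_filter.2 ⟨he, hve⟩
      rw [pairForm_update_of_notMem m c hve, pairForm_add, pairForm_smul, hu e he', hu₀.1 e he',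
        mul_zero, add_zero]
  · by_cases hw : w = v
    · subst hw
      rw [Function.update_self, Function.update_self, hzs]
    · rw [Function.update_of_ne hw, Function.update_of_ne hw, Pi.add_apply, Pi.smul_apply,
        add_dotProduct, smul_dotProduct, hus, hu₀.2, smul_zero, add_zero]

theorem isPolyFun_pairForm (e : Sym2 V) (u : V → Fin 3 → ℚ) :
    IsPolyFun fun q => pairForm m c q (fun v j => (u v j : ℝ)) e := by
  induction e with
  | _ a b =>
    simp only [pairForm_mk]
    exact (((IsPolyVec.const (u a)).sub (.const (u b))).dotProduct
      ((IsPolyVec.point a).sub (.point b))).add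
      (.ite ((IsPolyVec.const (u a)).dotProduct
        ((IsPolyVec.grad m a).cross (.motion c (.point a)))) .zero)

variable [Fintype V]

/-- The linear forms of `E` and of tangentiality, together with further linear forms. -/
def constraintMap (m : MvPolynomial (Fin 3) ℚ) (c : Fin 3 ⊕ Fin 3 → ℚ) (E : Finset (Sym2 V))
    {κ : Type*} (l : (V → Fin 3 → ℝ) →ₗ[ℝ] (κ → ℝ)) (p : V → Fin 3 → ℝ) :
    (V → Fin 3 → ℝ) →ₗ[ℝ] (E ⊕ V ⊕ κ → ℝ) where
  toFun u := Sum.elim (fun e => pairForm m c p u e) (Sum.elim (fun v => u v ⬝ᵥ grad m (p v)) (l u))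
  map_add' u u' := by
    ext (e | v | k)
    · exact pairForm_add m c p u u' e
    · exact add_dotProduct (u v) (u' v) _
    · exact congrFun (map_add l u u') k
  map_smul' r u := by
    ext (e | v | k)
    · exact pairForm_smul m c p u r e
    · exact smul_dotProduct r (u v) _
    · exact congrFun (map_smul l r u) k

/-- Independence of the constraints and further polynomial linear forms passes from any points
of `m = 0` to generic points. -/
theorem IsGeneric.exists_of_forall_exists {p q : V → Fin 3 → ℝ} (hp : IsGeneric m p)
    (hq : ∀ v, aeval (q v) m = 0) {E : Finset (Sym2 V)} {κ : Type*} [Finite κ]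
    {l : (V → Fin 3 → ℝ) → (V → Fin 3 → ℝ) →ₗ[ℝ] (κ → ℝ)}
    (hl : ∀ (k : κ) (u : V → Fin 3 → ℚ), IsPolyFun fun q => l q (fun v j => (u v j : ℝ)) k)
    (h : ∀ (t : Sym2 V → ℝ) (s : V → ℝ) (r : κ → ℝ), ∃ u : V → Fin 3 → ℝ,
      (∀ e ∈ E, pairForm m c q u e = t e) ∧ (∀ v, u v ⬝ᵥ grad m (q v) = s v) ∧ l q u = r)
    (t : Sym2 V → ℝ) (s : V → ℝ) (r : κ → ℝ) : ∃ u : V → Fin 3 → ℝ,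
      (∀ e ∈ E, pairForm m c p u e = t e) ∧ (∀ v, u v ⬝ᵥ grad m (p v) = s v) ∧ l p u = r := by
  have hsurj : Function.Surjective (constraintMap m c E (l q) q) := by
    intro y
    obtain ⟨u, h1, h2, h3⟩ := h (fun e => if he : e ∈ E then y (Sum.inl ⟨e, he⟩) else 0)
      (fun v => y (Sum.inr (Sum.inl v))) (fun k => y (Sum.inr (Sum.inr k)))
    refine ⟨u, ?_⟩
    ext (e | v | k)
    · exact (h1 e e.2).trans (dif_pos e.2)
    · exact h2 v
    · exact congrFun h3 k
  have hsurj' := hp.surjective (φ := fun q => constraintMap m c E (l q) q) (by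
    rintro (e | v | k) u
    · exact isPolyFun_pairForm e.1 u
    · exact (IsPolyVec.const (u v)).dotProduct (.grad m v)
    · exact hl k u) hq hsurj
  obtain ⟨u, hu⟩ := hsurj' (Sum.elim (fun e => t e) (Sum.elim s r))
  exact ⟨u, fun e he => congrFun hu (Sum.inl ⟨e, he⟩), fun v => congrFun hu (Sum.inr (Sum.inl v)),
    funext fun k => congrFun hu (Sum.inr (Sum.inr k))⟩

theorem LoopIndependent.of_special {p q : V → Fin 3 → ℝ} {E : Finset (Sym2 V)}
    (h : LoopIndependent m c E q) (hp : IsGeneric m p) (hq : ∀ v, aeval (q v) m = 0) :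
    LoopIndependent m c E p := fun t s => by
  obtain ⟨u, h1, h2, -⟩ := hp.exists_of_forall_exists (c := c) (E := E) (κ := Empty) (l := 0) hq
    (fun k => k.elim) (fun t s r => by
      obtain ⟨u, h1, h2⟩ := h t s
      exact ⟨u, h1, h2, Subsingleton.elim _ _⟩) t s 0
  exact ⟨u, h1, h2⟩

end Constraints

/-! ### Differentiability -/

section Smooth

theorem contDiff_aeval (h : MvPolynomial (Fin 3) ℚ) :
    ContDiff ℝ 1 fun x : Fin 3 → ℝ => aeval x h := by
  induction h using MvPolynomial.induction_on with
  | C r => simpa using contDiff_const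
  | add f g hf hg => simpa using hf.add hg
  | mul_X f j hf => simpa using hf.mul (contDiff_apply ℝ ℝ j)

theorem contDiff_grad (m : MvPolynomial (Fin 3) ℚ) : ContDiff ℝ 1 (grad m) :=
  contDiff_pi.2 fun i => contDiff_aeval (pderiv i m)

theorem contDiff_dotProduct {f g : (Fin 3 → ℝ) → Fin 3 → ℝ} (hf : ContDiff ℝ 1 f)
    (hg : ContDiff ℝ 1 g) : ContDiff ℝ 1 fun x => f x ⬝ᵥ g x :=
  ContDiff.sum fun i _ => (contDiff_pi.1 hf i).mul (contDiff_pi.1 hg i)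

theorem contDiff_cross {f g : (Fin 3 → ℝ) → Fin 3 → ℝ} (hf : ContDiff ℝ 1 f)
    (hg : ContDiff ℝ 1 g) : ContDiff ℝ 1 fun x => f x ⨯₃ g x := by
  rw [contDiff_pi] at *
  intro i
  fin_cases i
  · simpa only [cross_apply_zero, Fin.zero_eta] using
      ((hf 1).mul (hg 2)).sub ((hf 2).mul (hg 1))
  · simpa only [cross_apply_one, Fin.mk_one] using
      ((hf 2).mul (hg 0)).sub ((hf 0).mul (hg 2))
  · simpa only [cross_apply_two, Fin.reduceFinMk] using
      ((hf 0).mul (hg 1)).sub ((hf 1).mul (hg 0))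

theorem contDiff_motion (k : Fin 3 ⊕ Fin 3 → ℝ) : ContDiff ℝ 1 (motion k) :=
  (contDiff_cross contDiff_const contDiff_id).add contDiff_const

/-- Since `x - a` vanishes at `a`, the derivative there of `(x - a) · Q(x)` is `Q(a)`, and Lagrange
multipliers apply. -/
theorem IsIrreducibleSurface.exists_eq_smul_grad_of_dotProduct {m : MvPolynomial (Fin 3) ℚ}
    {M : Set (Fin 3 → ℝ)} (hM : IsIrreducibleSurface m M) {a : Fin 3 → ℝ} (ha : a ∈ M)
    {Q : (Fin 3 → ℝ) → Fin 3 → ℝ} (hQ : ContDiff ℝ 1 Q)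
    (h : ∀ x ∈ M, (x - a) ⬝ᵥ Q x = 0) : ∃ l : ℝ, Q a = l • grad m a := by
  have hQi : ∀ i, HasStrictFDerivAt (fun x => Q x i) (fderiv ℝ (fun x => Q x i) a) a := fun i =>
    (contDiff_pi.1 hQ i).contDiffAt.hasStrictFDerivAt one_ne_zero
  have hXi : ∀ i, HasStrictFDerivAt (fun x : Fin 3 → ℝ => x i - a i)
      (ContinuousLinearMap.proj (R := ℝ) (φ := fun _ : Fin 3 => ℝ) i) a := fun i =>
    (ContinuousLinearMap.proj (R := ℝ) (φ := fun _ : Fin 3 => ℝ) i).hasStrictFDerivAt.sub_const _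
  have hF := HasStrictFDerivAt.fun_sum (u := Finset.univ) fun i _ => (hXi i).mul (hQi i)
  refine hM.exists_eq_smul_grad ha hF (fun τ => ?_) fun x hx => ?_
  · simp [dotProduct]
  · refine (h x hx).trans ?_
    simp

/-- If a `4 × 4` determinant with first row `(x - a, u_a · (x - a))` vanishes along the surface,
then the tangent vector `u_a` at `a` satisfies the equations of the two following rows. -/
theorem IsIrreducibleSurface.eq_of_forall_det_eq_zero {m : MvPolynomial (Fin 3) ℚ}
    {M : Set (Fin 3 → ℝ)} (hM : IsIrreducibleSurface m M) {a : Fin 3 → ℝ} (ha : a ∈ M)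
    {u : Fin 3 → ℝ} (hu : u ⬝ᵥ grad m a = 0) {r s : (Fin 3 → ℝ) → Fin 3 → ℝ}
    {ρ σ : (Fin 3 → ℝ) → ℝ} (hr : ContDiff ℝ 1 r) (hs : ContDiff ℝ 1 s) (hρ : ContDiff ℝ 1 ρ)
    (hσ : ContDiff ℝ 1 σ) (hne : triple (r a) (s a) (grad m a) ≠ 0)
    (h : ∀ x ∈ M, (x - a) ⬝ᵥ ((ρ x - u ⬝ᵥ r x) • (s x ⨯₃ grad m x) -
      (σ x - u ⬝ᵥ s x) • (r x ⨯₃ grad m x) + (-(u ⬝ᵥ grad m x)) • (r x ⨯₃ s x)) = 0) :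
    u ⬝ᵥ r a = ρ a ∧ u ⬝ᵥ s a = σ a := by
  have hu' : ContDiff ℝ 1 fun _ : Fin 3 → ℝ => u := contDiff_const
  have hg := contDiff_grad m
  obtain ⟨l, hl⟩ := hM.exists_eq_smul_grad_of_dotProduct ha
    ((((hρ.sub (contDiff_dotProduct hu' hr)).smul (contDiff_cross hs hg)).sub
      ((hσ.sub (contDiff_dotProduct hu' hs)).smul (contDiff_cross hr hg))).add
      ((contDiff_dotProduct hu' hg).neg.smul (contDiff_cross hr hs))) h
  have hn := hM.grad_ne_zero ha
  replace hl : (ρ a - u ⬝ᵥ r a) • (s a ⨯₃ grad m a) - (σ a - u ⬝ᵥ s a) • (r a ⨯₃ grad m a) +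
    (-(u ⬝ᵥ grad m a)) • (r a ⨯₃ s a) = l • grad m a := hl
  generalize hA : ρ a - u ⬝ᵥ r a = A at hl
  generalize hB : σ a - u ⬝ᵥ s a = B at hl
  rw [hu, neg_zero, zero_smul, add_zero] at hl
  generalize grad m a = n at *
  have hnn : n ⬝ᵥ n ≠ 0 := fun h => hn (dotProduct_self_eq_zero.1 h)
  -- The third term dropped out because `u` is tangential, and the two remaining cross products are
  -- orthogonal to `n`.
  have hl0 : l = 0 := by
    have := congrArg (fun y => n ⬝ᵥ y) hl
    simpa [hnn] using this.symm
  rw [hl0, zero_smul] at hl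
  have hA0 : A = 0 := by
    have := congrArg (fun y => r a ⬝ᵥ y) hl
    simp only [dotProduct_sub, dotProduct_smul, dot_self_cross, dotProduct_zero, smul_eq_mul,
      mul_zero, sub_zero] at this
    exact (mul_eq_zero.1 this).resolve_right hne
  have hB0 : B = 0 := by
    rw [hA0, zero_smul, zero_sub, neg_eq_zero] at hl
    refine (smul_eq_zero.1 hl).resolve_right fun h0 => hne ?_
    rw [triple, triple_product_permutation, ← neg_cross, h0, neg_zero, dotProduct_zero]
  exact ⟨by linarith, by linarith⟩

end Smooth

/-! ### Adding a vertex of degree at most three -/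

section Extension

variable {V : Type*} [DecidableEq V] {m : MvPolynomial (Fin 3) ℚ} {M : Set (Fin 3 → ℝ)}
  {c : Fin 3 ⊕ Fin 3 → ℚ} {p : V → Fin 3 → ℝ}

theorem contDiff_nbrVec (v o : V) : ContDiff ℝ 1 (nbrVec m c p v o) := by
  unfold nbrVec
  split_ifs
  · exact contDiff_cross (contDiff_grad m) (contDiff_motion _)
  · exact contDiff_id.sub contDiff_const

theorem contDiff_nbrVal (u : V → Fin 3 → ℝ) (v o : V) : ContDiff ℝ 1 (nbrVal p u v o) := by
  unfold nbrVal
  split_ifs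
  · exact contDiff_const
  · exact contDiff_dotProduct contDiff_const (contDiff_id.sub contDiff_const)

/-- A nonzero rigid motion with rational coefficients that is tangential along `M`. -/
structure IsSlide (m : MvPolynomial (Fin 3) ℚ) (M : Set (Fin 3 → ℝ)) (c : Fin 3 ⊕ Fin 3 → ℚ) :
    Prop where
  ne_zero : c ≠ 0
  mem : (fun i => (c i : ℝ)) ∈ slides m M

theorem triple_loopVec {n w y : Fin 3 → ℝ} (h : w ⬝ᵥ n = 0) :
    triple (n ⨯₃ w) y n = -((n ⬝ᵥ n) * (w ⬝ᵥ y)) := by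
  rw [triple, cross_dot_cross, h]
  ring

/-- The disjunctions cover two uses: `b = v`, and `b` a neighbour on which `v` is placed. Two edges
reduce to `GenericOn.triple_grad_ne_zero`; a loop and an edge reduce to the slide velocity not being
orthogonal to the edge. -/
theorem GenericOn.triple_nbrVec_ne_zero (h : GenericOn m M p) (hc : IsSlide m M c) {v b o o' : V}
    (hoo : o ≠ o') (ho : o = v ∨ o ≠ b) (ho' : o' = v ∨ o' ≠ b) :
    triple (nbrVec m c p v o (p b)) (nbrVec m c p v o' (p b)) (grad m (p b)) ≠ 0 := by
  have key : ∀ o, o ≠ b → triple (loopVec m c (p b)) (p b - p o) (grad m (p b)) ≠ 0 := by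
    intro o ho
    rw [loopVec, triple_loopVec (hc.mem _ (h.mem b)), neg_ne_zero]
    exact mul_ne_zero (fun h0 => h.surface.grad_ne_zero (h.mem b) (dotProduct_self_eq_zero.1 h0))
      (h.motion_dotProduct_ne_zero hc.ne_zero ho.symm)
  unfold nbrVec
  by_cases h1 : o = v
  · have h2 : o' ≠ v := fun h2 => hoo (h1.trans h2.symm)
    rw [if_pos h1, if_neg h2]
    exact key o' (ho'.resolve_left h2)
  · rw [if_neg h1]
    by_cases h2 : o' = v
    · rw [if_pos h2]
      intro h0
      apply key o (ho.resolve_left h1)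
      rw [triple] at h0 ⊢
      rw [triple_product_permutation, ← neg_cross, dotProduct_neg, h0, neg_zero]
    · rw [if_neg h2]
      exact h.triple_grad_ne_zero (ho.resolve_left h1).symm (ho'.resolve_left h2).symm hoo

theorem GenericOn.cross_nbrVec_ne_zero (h : GenericOn m M p) (hc : IsSlide m M c) {v b o : V}
    (ho : o = v ∨ o ≠ b) : nbrVec m c p v o (p b) ⨯₃ grad m (p b) ≠ 0 := by
  unfold nbrVec
  split_ifs with h1
  · intro h0
    have hn : grad m (p b) ⬝ᵥ grad m (p b) ≠ 0 := fun h0 =>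
      h.surface.grad_ne_zero (h.mem b) (dotProduct_self_eq_zero.1 h0)
    have hw := h.motion_ne_zero hc.ne_zero b
    have ht := hc.mem _ (h.mem b)
    rw [loopVec] at h0
    generalize motion (fun i => (c i : ℝ)) (p b) = w at *
    have h2 : (grad m (p b) ⨯₃ w) ⬝ᵥ (grad m (p b) ⨯₃ w) = 0 := by
      rw [← triple_product_permutation, h0, dotProduct_zero]
    rw [cross_dot_cross, ht, mul_zero, sub_zero] at h2
    exact hw (dotProduct_self_eq_zero.1 ((mul_eq_zero.1 h2).resolve_left hn))
  · exact h.cross_grad_ne_zero (ho.resolve_left h1).symm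

/-- Independence extends to a vertex of degree at most two. -/
theorem GenericOn.loopIndependent_of_card_le_two [Fintype V] (h : GenericOn m M p)
    (hc : IsSlide m M c) {E : Finset (Sym2 V)} {v : V} (hv : (nbrs E v).Nonempty)
    (hcard : (nbrs E v).card ≤ 2) (hE : LoopIndependent m c (E.filter (v ∉ ·)) p) :
    LoopIndependent m c E p := by
  rw [← Function.update_eq_self v p]
  refine hE.extend (.zero _ _) (p v) fun u t σ => ?_
  have hself : ∀ o, o = v ∨ o ≠ v := fun o => em _
  rcases Nat.lt_or_ge 1 (nbrs E v).card with h1 | h1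
  · obtain ⟨o, o', hoo, hn⟩ := Finset.card_eq_two.1 (le_antisymm hcard h1)
    obtain ⟨z, hz1, hz2, hz3⟩ := exists_dotProduct_eq_of_triple_ne_zero
      (h.triple_nbrVec_ne_zero hc hoo (hself o) (hself o'))
      (t o + nbrVal p u v o (p v)) (t o' + nbrVal p u v o' (p v)) σ
    refine ⟨z, 0, fun w hw => ?_, hz3⟩
    rw [← mem_nbrs, hn, Finset.mem_insert, Finset.mem_singleton] at hw
    rcases hw with rfl | rfl
    · rw [hz1]; ring
    · rw [hz2]; ring
  · obtain ⟨o, hn⟩ := Finset.card_eq_one.1 (le_antisymm h1 hv.card_pos)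
    obtain ⟨z, hz1, hz2⟩ := exists_dotProduct_eq_of_cross_ne_zero
      (h.cross_nbrVec_ne_zero hc (hself o)) (t o + nbrVal p u v o (p v)) σ
    refine ⟨z, 0, fun w hw => ?_, hz2⟩
    rw [← mem_nbrs, hn, Finset.mem_singleton] at hw
    subst hw
    rw [hz1]; ring

/-- If a vertex `v` of degree three does not extend independence, then every flex of the rest
satisfies the constraints of edges or loops between the neighbours of `v`. -/
theorem GenericOn.pairForm_eq_zero_of_not_loopIndependent [Fintype V] (h : GenericOn m M p)
    (hc : IsSlide m M c) {E : Finset (Sym2 V)} {v a o o' : V}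
    (hn : nbrs E v = {a, o, o'}) (hav : a ≠ v) (hao : a ≠ o) (hao' : a ≠ o') (hoo : o ≠ o')
    (hE : LoopIndependent m c (E.filter (v ∉ ·)) p) (hno : ¬ LoopIndependent m c E p)
    {u : V → Fin 3 → ℝ} (hu : IsLoopFlex m c (E.filter (v ∉ ·)) p u) :
    pairForm m c p u s(a, if o = v then a else o) = 0 ∧
      pairForm m c p u s(a, if o' = v then a else o') = 0 := by
  rw [pairForm_update_of_ne hao, pairForm_update_of_ne hao', sub_eq_zero, sub_eq_zero]
  refine h.surface.eq_of_forall_det_eq_zero (h.mem a) (hu.2 a) (contDiff_nbrVec v o)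
    (contDiff_nbrVec v o') (contDiff_nbrVal u v o) (contDiff_nbrVal u v o')
    (h.triple_nbrVec_ne_zero hc hoo (Or.inr hao.symm) (Or.inr hao'.symm)) fun x hx => ?_
  -- If the determinant were nonzero at one `x ∈ M`, the framework with `v` at `x` would be
  -- independent, and hence so would the generic one.
  by_contra hdet
  apply hno
  have hsp : LoopIndependent m c E (Function.update p v x) := by
    refine hE.extend hu x fun u₁ t σ => ?_
    obtain ⟨y, l, h1, h2, h3, h4⟩ := exists_solution_of_ne_zero hdet
      (t a + u₁ a ⬝ᵥ (x - p a)) (t o + nbrVal p u₁ v o x) (t o' + nbrVal p u₁ v o' x) σ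
    -- Measuring the velocity of `v` relative to `l • u a` removes `l` from the equation of the edge
    -- `va`.
    refine ⟨y + l • u a, l, fun w hw => ?_, ?_⟩
    · rw [← mem_nbrs, hn, Finset.mem_insert, Finset.mem_insert, Finset.mem_singleton] at hw
      rcases hw with rfl | rfl | rfl
      · rw [nbrVec, nbrVal, nbrVal, if_neg hav, if_neg hav, if_neg hav, add_dotProduct, h1,
          smul_dotProduct, smul_eq_mul]
        ring
      · rw [add_dotProduct, smul_dotProduct, smul_eq_mul]
        linarith
      · rw [add_dotProduct, smul_dotProduct, smul_eq_mul]
        linarith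
    · rw [add_dotProduct, smul_dotProduct, smul_eq_mul]
      linarith
  refine hsp.of_special h.generic fun w => ?_
  by_cases hw : w = v
  · subst hw
    rw [Function.update_self]
    exact h.surface.aeval_eq_zero hx
  · rw [Function.update_of_ne hw]
    exact h.surface.aeval_eq_zero (h.mem w)

/-- A vertex joined to a triangle extends independence if some flex of the rest moves the triangle
by a rigid motion that is not tangential at the new vertex. -/
theorem LoopIndependent.extend_triangle [Fintype V] {E : Finset (Sym2 V)} {v a b d : V}
    (hE : LoopIndependent m c (E.filter (v ∉ ·)) p) (hn : nbrs E v ⊆ {a, b, d})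
    (hva : a ≠ v) (hvb : b ≠ v) (hvd : d ≠ v)
    (hne : triple (p a - p v) (p b - p v) (p d - p v) ≠ 0)
    {u : V → Fin 3 → ℝ} (hu : IsLoopFlex m c (E.filter (v ∉ ·)) p u) {k : Fin 3 ⊕ Fin 3 → ℝ}
    (hka : motion k (p a) = u a) (hkb : motion k (p b) = u b) (hkd : motion k (p d) = u d)
    (hk : motion k (p v) ⬝ᵥ grad m (p v) ≠ 0) : LoopIndependent m c E p := by
  rw [← Function.update_eq_self v p]
  refine hE.extend hu (p v) fun u₁ t σ => ?_
  -- `y` solves the three edge equations. Adding `l` times the rigid motion at `v` and `l • u` on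
  -- the rest preserves them, which leaves `l` free for the normal component.
  obtain ⟨y, hya, hyb, hyd⟩ := exists_dotProduct_eq_of_triple_ne_zero hne
    (-(t a + nbrVal p u₁ v a (p v))) (-(t b + nbrVal p u₁ v b (p v)))
    (-(t d + nbrVal p u₁ v d (p v)))
  set l := (σ - y ⬝ᵥ grad m (p v)) / (motion k (p v) ⬝ᵥ grad m (p v)) with hl
  have key : ∀ w, w ≠ v → motion k (p w) = u w →
      y ⬝ᵥ (p w - p v) = -(t w + nbrVal p u₁ v w (p v)) →
      (y + l • motion k (p v)) ⬝ᵥ nbrVec m c p v w (p v) -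
        (nbrVal p u₁ v w (p v) + l * nbrVal p u v w (p v)) = t w := by
    intro w hw hkw hyw
    have h1 := motion_sub_dotProduct k (p v) (p w)
    rw [hkw, sub_dotProduct] at h1
    have h2 : y ⬝ᵥ (p v - p w) = - (y ⬝ᵥ (p w - p v)) := by
      rw [← dotProduct_neg, neg_sub]
    have h3 : nbrVal p u v w (p v) = u w ⬝ᵥ (p v - p w) := if_neg hw
    rw [h3, nbrVec, if_neg hw, add_dotProduct, smul_dotProduct, smul_eq_mul, h2, hyw]
    linear_combination l * h1
  refine ⟨y + l • motion k (p v), l, fun w hw => ?_, ?_⟩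
  · have := hn (mem_nbrs.2 hw)
    rw [Finset.mem_insert, Finset.mem_insert, Finset.mem_singleton] at this
    rcases this with rfl | rfl | rfl
    · exact key _ hva hka hya
    · exact key _ hvb hkb hyb
    · exact key _ hvd hkd hyd
  · rw [add_dotProduct, smul_dotProduct, smul_eq_mul, hl, div_mul_cancel₀ _ hk]
    ring

end Extension

/-! ### The induction on sparse graphs with loops -/

section Main

variable {V : Type*} {m : MvPolynomial (Fin 3) ℚ} {M : Set (Fin 3 → ℝ)}
  {c : Fin 3 ⊕ Fin 3 → ℚ} {p : V → Fin 3 → ℝ}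

/-- On a surface of type one, all tangential rigid motions are multiples of one of them. -/
theorem IsSlide.exists_eq_smul (hc : IsSlide m M c) (hM : IsIrreducibleSurface m M)
    (ht : HasType m M 1) {k : Fin 3 ⊕ Fin 3 → ℝ} (hk : k ∈ slides m M) :
    ∃ l : ℝ, k = l • fun i => (c i : ℝ) := by
  have hne : (⟨_, hc.mem⟩ : slides m M) ≠ 0 := fun h => hc.ne_zero (by
    ext i
    have := congrFun (congrArg Subtype.val h) i
    simpa using this)
  obtain ⟨l, hl⟩ := (finrank_eq_one_iff_of_nonzero' _ hne).1 (ht.finrank_slides hM) ⟨k, hk⟩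
  exact ⟨l, (congrArg Subtype.val hl).symm⟩

theorem scaledAngular_add (e₁ e₂ d₁ d₂ d₁' d₂' : Fin 3 → ℝ) :
    scaledAngular e₁ e₂ (d₁ + d₁') (d₂ + d₂') =
      scaledAngular e₁ e₂ d₁ d₂ + scaledAngular e₁ e₂ d₁' d₂' := by
  simp only [scaledAngular, add_dotProduct, add_smul]
  abel

theorem scaledAngular_smul (e₁ e₂ d₁ d₂ : Fin 3 → ℝ) (r : ℝ) :
    scaledAngular e₁ e₂ (r • d₁) (r • d₂) = r • scaledAngular e₁ e₂ d₁ d₂ := by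
  simp only [scaledAngular, smul_dotProduct, smul_eq_mul, mul_smul, smul_add, smul_sub]

/-- Up to a positive factor, the normal velocity of the vertex `v` under the rigid motion that
moves `a`, `b`, `d` with the velocities `u a`, `u b`, `u d`. -/
def normalVelocity (m : MvPolynomial (Fin 3) ℚ) (v a b d : V) (q : V → Fin 3 → ℝ) :
    (V → Fin 3 → ℝ) →ₗ[ℝ] ℝ where
  toFun u := (scaledAngular (q b - q a) (q d - q a) (u b - u a) (u d - u a) ⨯₃ (q v - q a) +
    (((q b - q a) ⨯₃ (q d - q a)) ⬝ᵥ ((q b - q a) ⨯₃ (q d - q a))) • u a) ⬝ᵥ grad m (q v)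
  map_add' u u' := by
    have h : ∀ w, (u + u') w - (u + u') a = (u w - u a) + (u' w - u' a) := fun w => by
      simp only [Pi.add_apply]
      abel
    rw [h, h, scaledAngular_add, map_add, LinearMap.add_apply, Pi.add_apply, smul_add]
    simp only [add_dotProduct]
    ring
  map_smul' r u := by
    have h : ∀ w, (r • u) w - (r • u) a = r • (u w - u a) := fun w => by
      simp only [Pi.smul_apply, smul_sub]
    rw [h, h, scaledAngular_smul, map_smul, LinearMap.smul_apply, Pi.smul_apply, smul_comm _ r,
      ← smul_add, smul_dotProduct, RingHom.id_apply]

theorem isPolyFun_normalVelocity (v a b d : V) (u : V → Fin 3 → ℚ) :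
    IsPolyFun fun q => normalVelocity m v a b d q fun v j => (u v j : ℝ) := by
  have hu : ∀ w, IsPolyVec fun _ : V → Fin 3 → ℝ => fun j => (u w j : ℝ) := fun w => .const (u w)
  have h1 : IsPolyVec fun q : V → Fin 3 → ℝ => q b - q a := (IsPolyVec.point b).sub (.point a)
  have h2 : IsPolyVec fun q : V → Fin 3 → ℝ => q d - q a := (IsPolyVec.point d).sub (.point a)
  have hν := h1.cross h2
  have h3 := (hu b).sub (hu a)
  have h4 := (hu d).sub (hu a)
  have h5 : IsPolyVec fun q : V → Fin 3 → ℝ => q v - q a := (IsPolyVec.point v).sub (.point a)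
  have hω := (((IsPolyVec.smul (h3.dotProduct h2) hν).add (.smul (h4.dotProduct hν) h1)).sub
    (.smul (h3.dotProduct hν) h2))
  exact ((hω.cross h5).add (.smul (hν.dotProduct hν) (hu a))).dotProduct (.grad m v)

theorem normalVelocity_eq {v a b d : V} {q u : V → Fin 3 → ℝ} {k : Fin 3 ⊕ Fin 3 → ℝ}
    (hk : ∀ x, (((q b - q a) ⨯₃ (q d - q a)) ⬝ᵥ ((q b - q a) ⨯₃ (q d - q a))) • motion k x =
      scaledAngular (q b - q a) (q d - q a) (u b - u a) (u d - u a) ⨯₃ (x - q a) +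
        (((q b - q a) ⨯₃ (q d - q a)) ⬝ᵥ ((q b - q a) ⨯₃ (q d - q a))) • u a) :
    normalVelocity m v a b d q u = (((q b - q a) ⨯₃ (q d - q a)) ⬝ᵥ
      ((q b - q a) ⨯₃ (q d - q a))) * (motion k (q v) ⬝ᵥ grad m (q v)) := by
  rw [← smul_eq_mul, ← smul_dotProduct, hk]
  rfl

variable [DecidableEq V] [Fintype V]

/-- If every flex of the rest preserves the triangle of the neighbours of `v`, and `v` does not
extend independence, then the flexes move the triangle tangentially. -/
theorem GenericOn.exists_slide_of_not_loopIndependent (h : GenericOn m M p)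
    {E : Finset (Sym2 V)} {v a b d : V} (hn : nbrs E v ⊆ {a, b, d})
    (hva : a ≠ v) (hvb : b ≠ v) (hvd : d ≠ v) (hab : a ≠ b) (had : a ≠ d) (hbd : b ≠ d)
    (hE : LoopIndependent m c (E.filter (v ∉ ·)) p) (hno : ¬ LoopIndependent m c E p)
    (hflex : ∀ u, IsLoopFlex m c (E.filter (v ∉ ·)) p u → pairForm m c p u s(a, b) = 0 ∧
      pairForm m c p u s(a, d) = 0 ∧ pairForm m c p u s(b, d) = 0)
    {u : V → Fin 3 → ℝ} (hu : IsLoopFlex m c (E.filter (v ∉ ·)) p u) :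
    ∃ k ∈ slides m M, motion k (p a) = u a ∧ motion k (p b) = u b ∧ motion k (p d) = u d := by
  have hcop : triple (p a - p v) (p b - p v) (p d - p v) ≠ 0 :=
    h.triple_ne_zero hva.symm hvb.symm hvd.symm hab had hbd
  have hν : (p b - p a) ⨯₃ (p d - p a) ≠ 0 := by
    intro h0
    apply h.triple_ne_zero hab had hva hbd hvb hvd
    rw [triple, triple_product_permutation, triple_product_permutation, h0, dotProduct_zero]
  set N := ((p b - p a) ⨯₃ (p d - p a)) ⬝ᵥ ((p b - p a) ⨯₃ (p d - p a)) with hN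
  have hN0 : N ≠ 0 := fun h0 => hν (dotProduct_self_eq_zero.1 h0)
  have htri : ∀ u, IsLoopFlex m c (E.filter (v ∉ ·)) p u → ∃ k, motion k (p a) = u a ∧
      motion k (p b) = u b ∧ motion k (p d) = u d ∧ ∀ x, N • motion k x =
        scaledAngular (p b - p a) (p d - p a) (u b - u a) (u d - u a) ⨯₃ (x - p a) + N • u a := by
    intro u hu
    obtain ⟨h1, h2, h3⟩ := hflex u hu
    rw [pairForm_of_ne m c _ _ hab] at h1
    rw [pairForm_of_ne m c _ _ had] at h2
    rw [pairForm_of_ne m c _ _ hbd] at h3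
    exact exists_motion_of_triangle hν h1 h2 h3
  obtain ⟨k, hka, hkb, hkd, hk⟩ := htri u hu
  refine ⟨k, fun x hx => ?_, hka, hkb, hkd⟩
  by_contra hx0
  apply hno
  set q := Function.update p v x with hq
  have hqa : ∀ w, w ≠ v → q w = p w := fun w hw => Function.update_of_ne hw _ _
  have hqv : q v = x := Function.update_self _ _ _
  -- No remaining edge meets `v`, so its velocity may be zero, which is tangential at every
  -- position.
  set u' := Function.update u v 0 with hu'
  have hva' : ∀ w, w ≠ v → u' w = u w := fun w hw => Function.update_of_ne hw _ _
  have hl : normalVelocity m v a b d q u' ≠ 0 := by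
    rw [normalVelocity_eq (k := k), hqv, hqa a hva, hqa b hvb, hqa d hvd]
    · exact mul_ne_zero hN0 hx0
    · rw [hqa a hva, hqa b hvb, hqa d hvd, hva' a hva, hva' b hvb, hva' d hvd]
      exact hk
  -- With `v` at `x`, adding multiples of `u'` adjusts the normal velocity without affecting the
  -- other constraints. So the normal velocity is independent of them there, and therefore also at
  -- `p`.
  have hgen := h.generic.exists_of_forall_exists (c := c) (q := q) (E := E.filter (v ∉ ·))
    (κ := Unit) (l := fun q => LinearMap.pi fun _ => normalVelocity m v a b d q) (fun w => by
      by_cases hw : w = v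
      · rw [hw, hqv]
        exact h.surface.aeval_eq_zero hx
      · rw [hqa w hw]
        exact h.surface.aeval_eq_zero (h.mem w)) (fun _ u => isPolyFun_normalVelocity v a b d u)
    (fun t s r => by
      obtain ⟨u₁, h1, h2⟩ := hE t s
      have hx00 : grad m x ⬝ᵥ grad m x ≠ 0 := fun h0 =>
        h.surface.grad_ne_zero hx (dotProduct_self_eq_zero.1 h0)
      set u₂ := Function.update u₁ v ((s v / (grad m x ⬝ᵥ grad m x)) • grad m x) with hu₂
      set l := (r () - normalVelocity m v a b d q u₂) / normalVelocity m v a b d q u' with hl'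
      refine ⟨u₂ + l • u', fun e he => ?_, fun w => ?_, ?_⟩
      · have hve := (Finset.mem_filter.1 he).2
        rw [pairForm_add, pairForm_smul, pairForm_update_of_notMem m c hve,
          pairForm_update_of_notMem m c hve, h1 e he, hu.1 e he, mul_zero, add_zero]
      · rw [Pi.add_apply, Pi.smul_apply, add_dotProduct, smul_dotProduct]
        by_cases hw : w = v
        · rw [hw, hqv, hu', hu₂, Function.update_self, Function.update_self, zero_dotProduct,
            smul_zero, add_zero, smul_dotProduct, smul_eq_mul, div_mul_cancel₀ _ hx00]
        · rw [hqa w hw, hva' w hw, hu₂, Function.update_of_ne hw, h2, hu.2, smul_zero, add_zero]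
      · ext ⟨⟩
        change normalVelocity m v a b d q (u₂ + l • u') = r ()
        rw [map_add, map_smul, smul_eq_mul, hl', div_mul_cancel₀ _ hl]
        ring)
  -- A flex at `p` itself that carries the triangle by a motion not tangential at `v`, as the
  -- extension over a triangle requires.
  obtain ⟨w, hw1, hw2, hw3⟩ := hgen 0 0 1
  obtain ⟨k', hka', hkb', hkd', hk'⟩ := htri w ⟨hw1, hw2⟩
  refine hE.extend_triangle hn hva hvb hvd hcop ⟨hw1, hw2⟩ hka' hkb' hkd' fun h0 => ?_
  have h1 : normalVelocity m v a b d p w = 1 := congrFun hw3 ()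
  rw [normalVelocity_eq (k := k') hk', h0, mul_zero] at h1
  exact zero_ne_one h1

theorem dotProduct_loopVec_of_eq_motion {u x : Fin 3 → ℝ} {l : ℝ}
    (h : motion (l • fun i => (c i : ℝ)) x = u) : u ⬝ᵥ loopVec m c x = 0 := by
  rw [← h, motion_smul, smul_dotProduct, loopVec, dot_cross_self, smul_zero]

/-- **Main theorem on independence**: on a surface of type one with a rational tangential rigid
motion, the constraints of a sparse graph with loops are independent at generic points. -/
theorem GenericOn.loopIndependent (h : GenericOn m M p) (hc : IsSlide m M c)
    (E : Finset (Sym2 V)) (hE : LoopSparse E) : LoopIndependent m c E p := by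
  induction hcard : E.card using Nat.strong_induction_on generalizing E with
  | _ N ih =>
  by_cases hempty : E = ∅
  · subst hempty
    exact loopIndependent_empty fun v => h.surface.grad_ne_zero (h.mem v)
  obtain ⟨v, hv, hv3⟩ := hE.exists_card_nbrs_le_three (Finset.nonempty_iff_ne_empty.2 hempty)
  have hE'E : E.filter (v ∉ ·) ⊆ E := Finset.filter_subset _ _
  have hE' := hE.mono hE'E
  have hsum : (E.filter (v ∉ ·)).card + (nbrs E v).card = E.card := by
    rw [card_nbrs, add_comm]
    exact Finset.card_filter_add_card_filter_not _
  have hpos := hv.card_pos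
  have hI := ih (E.filter (v ∉ ·)).card (by omega) _ hE' rfl
  rcases Nat.lt_or_ge (nbrs E v).card 3 with h2 | h3
  · exact h.loopIndependent_of_card_le_two hc hv (by omega) hI
  by_contra hno
  have hthree := le_antisymm hv3 h3
  -- If adding `e` kept the graph sparse, induction would apply, as three edges were removed and one
  -- is added. It would give a flex of the rest on which the form of `e` equals 1.
  have blocked : ∀ e, (∀ u, IsLoopFlex m c (E.filter (v ∉ ·)) p u → pairForm m c p u e = 0) →
      e ∈ E.filter (v ∉ ·) ∨ ∃ T, LoopTight (E.filter (v ∉ ·)) T ∧ e ∈ T.sym2 := by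
    intro e he
    by_contra! hcon
    obtain ⟨heE, hT⟩ := hcon
    have hsp : LoopSparse (insert e (E.filter (v ∉ ·))) := by
      by_contra hns
      obtain ⟨T, hT1, hT2⟩ := exists_tight_of_not_sparse_insert hE' hns
      exact hT T hT1 hT2
    have hi := ih _ (by rw [Finset.card_insert_of_notMem heE]; omega) _ hsp rfl
    obtain ⟨u, hu1, hu2⟩ := hi (fun f => if f = e then 1 else 0) 0
    have h1 := hu1 e (Finset.mem_insert_self _ _)
    rw [if_pos rfl, he u ⟨fun f hf => ?_, hu2⟩] at h1
    · exact zero_ne_one h1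
    · rw [hu1 f (Finset.mem_insert_of_mem hf), if_neg]
      rintro rfl
      exact heE hf
  have tight_loop : ∀ a, (∀ u, IsLoopFlex m c (E.filter (v ∉ ·)) p u →
      pairForm m c p u s(a, a) = 0) → ∃ T, LoopTight (E.filter (v ∉ ·)) T ∧ a ∈ T := by
    intro a ha
    rcases blocked _ ha with h1 | ⟨T, hT, haT⟩
    · exact ⟨{a}, loopTight_singleton h1, Finset.mem_singleton_self a⟩
    · exact ⟨T, hT, (Finset.mk_mem_sym2_iff.1 haT).1⟩
  have tight_pair : ∀ a b, (∀ u, IsLoopFlex m c (E.filter (v ∉ ·)) p u →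
      pairForm m c p u s(a, a) = 0 ∧ pairForm m c p u s(b, b) = 0 ∧
        pairForm m c p u s(a, b) = 0) →
      ∃ T, LoopTight (E.filter (v ∉ ·)) T ∧ a ∈ T ∧ b ∈ T := by
    intro a b hab
    rcases blocked s(a, b) fun u hu => (hab u hu).2.2 with h1 | ⟨T, hT, haT⟩
    -- When `ab` is itself an edge, it links the tight sets that block the loops at its ends.
    · obtain ⟨S, hS, haS⟩ := tight_loop a fun u hu => (hab u hu).1
      obtain ⟨T, hT, hbT⟩ := tight_loop b fun u hu => (hab u hu).2.1
      exact ⟨S ∪ T, hS.union_of_mem hE' hT haS hbT h1, Finset.mem_union_left _ haS,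
        Finset.mem_union_right _ hbT⟩
    · exact ⟨T, hT, Finset.mk_mem_sym2_iff.1 haT⟩
  by_cases hvv : v ∈ nbrs E v
  · obtain ⟨a, b, hab, hn⟩ : ∃ a b, a ≠ b ∧ (nbrs E v).erase v = {a, b} :=
      Finset.card_eq_two.1 (by rw [Finset.card_erase_of_mem hvv, hthree])
    have hn' : nbrs E v = {v, a, b} := by rw [← hn, Finset.insert_erase hvv]
    have hav : a ≠ v := Finset.ne_of_mem_erase (hn ▸ Finset.mem_insert_self a {b})
    have hbv : b ≠ v :=
      Finset.ne_of_mem_erase (hn ▸ Finset.mem_insert_of_mem (Finset.mem_singleton_self b))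
    have hna : nbrs E v = {a, v, b} := by rw [hn', Finset.insert_comm]
    have hnb : nbrs E v = {b, v, a} := by
      rw [hn', Finset.pair_comm a b, Finset.insert_comm]
    -- Placing `v` at `a` turns its loop into a loop at `a` and the edge `vb` into `ab`; placing it
    -- at `b` yields the loop at `b`.
    obtain ⟨T, hT, haT, hbT⟩ := tight_pair a b fun u hu => by
      have h1 := h.pairForm_eq_zero_of_not_loopIndependent hc hna hav hav hab hbv.symm hI hno hu
      have h2 := h.pairForm_eq_zero_of_not_loopIndependent hc hnb hbv hbv hab.symm hav.symm hI hno
        hu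
      rw [if_pos rfl, if_neg hbv] at h1
      rw [if_pos rfl] at h2
      exact ⟨h1.1, h2.1, h1.2⟩
    refine hE.not_nbrs_subset h3 hT ?_
    rw [hn']
    intro w hw
    simp only [Finset.mem_insert, Finset.mem_singleton] at hw ⊢
    rcases hw with rfl | rfl | rfl
    · exact Or.inl rfl
    · exact Or.inr haT
    · exact Or.inr hbT
  · obtain ⟨a, b, d, hab, had, hbd, hn⟩ := Finset.card_eq_three.1 hthree
    have hne : ∀ w ∈ nbrs E v, w ≠ v := fun w hw h0 => hvv (h0 ▸ hw)
    have hav : a ≠ v := hne a (by simp [hn])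
    have hbv : b ≠ v := hne b (by simp [hn])
    have hdv : d ≠ v := hne d (by simp [hn])
    have hnb : nbrs E v = {b, a, d} := by rw [hn, Finset.insert_comm]
    have hedges : ∀ u, IsLoopFlex m c (E.filter (v ∉ ·)) p u → pairForm m c p u s(a, b) = 0 ∧
        pairForm m c p u s(a, d) = 0 ∧ pairForm m c p u s(b, d) = 0 := by
      intro u hu
      have h1 := h.pairForm_eq_zero_of_not_loopIndependent hc hn hav hab had hbd hI hno hu
      have h2 := h.pairForm_eq_zero_of_not_loopIndependent hc hnb hbv hab.symm hbd had hI hno hu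
      rw [if_neg hbv, if_neg hdv] at h1
      rw [if_neg hav, if_neg hdv] at h2
      exact ⟨h1.1, h1.2, h2.2⟩
    have hloops : ∀ u, IsLoopFlex m c (E.filter (v ∉ ·)) p u → pairForm m c p u s(a, a) = 0 ∧
        pairForm m c p u s(b, b) = 0 ∧ pairForm m c p u s(d, d) = 0 := by
      intro u hu
      -- Every flex carries the triangle by a slide, that is, by a multiple of `c`, and such
      -- velocities satisfy the loop constraints.
      obtain ⟨k, hk, hka, hkb, hkd⟩ := h.exists_slide_of_not_loopIndependent hn.subset hav hbv hdv
        hab had hbd hI hno hedges hu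
      obtain ⟨l, rfl⟩ := hc.exists_eq_smul h.surface h.type_one hk
      rw [pairForm_loop, pairForm_loop, pairForm_loop]
      exact ⟨dotProduct_loopVec_of_eq_motion hka, dotProduct_loopVec_of_eq_motion hkb,
        dotProduct_loopVec_of_eq_motion hkd⟩
    obtain ⟨S, hS, haS, hbS⟩ := tight_pair a b fun u hu =>
      ⟨(hloops u hu).1, (hloops u hu).2.1, (hedges u hu).1⟩
    obtain ⟨T, hT, hbT, hdT⟩ := tight_pair b d fun u hu =>
      ⟨(hloops u hu).2.1, (hloops u hu).2.2, (hedges u hu).2.2⟩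
    refine hE.not_nbrs_subset h3 (hS.union hE' hT ⟨b, Finset.mem_inter.2 ⟨hbS, hbT⟩⟩) ?_
    rw [hn]
    intro w hw
    simp only [Finset.mem_insert, Finset.mem_singleton, Finset.mem_union] at hw ⊢
    rcases hw with rfl | rfl | rfl
    · exact Or.inr (Or.inl haS)
    · exact Or.inr (Or.inl hbS)
    · exact Or.inr (Or.inr hdT)

end Main

/-! ### Small frameworks -/

theorem linearIndependent_row_iff_surjective {ι κ : Type*} [Finite ι] [Fintype κ]
    (A : Matrix ι κ ℝ) : LinearIndependent ℝ A.row ↔ Function.Surjective A.mulVec := by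
  classical
  have := Fintype.ofFinite ι
  rw [mulVec_surjective_iff_det_ne_zero, ← isUnit_iff_ne_zero, ← Matrix.isUnit_iff_isUnit_det,
    ← Matrix.linearIndependent_rows_iff_isUnit, linearIndependent_iff_card_eq_finrank_span,
    linearIndependent_iff_card_eq_finrank_span]
  have h1 := Matrix.rank_eq_finrank_span_row A
  have h2 := Matrix.rank_eq_finrank_span_row (A * Aᵀ)
  rw [Matrix.rank_self_mul_transpose] at h2
  unfold Set.finrank
  rw [← h1, ← h2]

theorem card_add_finrank_ker_of_linearIndependent {ι κ : Type*} [Fintype ι] [Fintype κ]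
    {A : Matrix ι κ ℝ} (h : LinearIndependent ℝ A.row) :
    Fintype.card ι + Module.finrank ℝ (LinearMap.ker A.mulVecLin) = Fintype.card κ := by
  have hs : Function.Surjective A.mulVecLin := (linearIndependent_row_iff_surjective A).1 h
  have := LinearMap.finrank_range_add_finrank_ker A.mulVecLin
  rwa [LinearMap.range_eq_top.2 hs, finrank_top, Module.finrank_fintype_fun_eq_card,
    Module.finrank_fintype_fun_eq_card] at this

section Small

variable {V : Type*} [DecidableEq V] {m : MvPolynomial (Fin 3) ℚ} {M : Set (Fin 3 → ℝ)}
  {c : Fin 3 ⊕ Fin 3 → ℚ} {p : V → Fin 3 → ℝ} [Fintype V]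

/-- Up to five normal lines are independent, so a rigid motion can have any prescribed normal
components. This replaces the rational slide for small vertex sets. -/
theorem GenericOn.exists_motion_dotProduct_eq (h : GenericOn m M p) (hV : Fintype.card V ≤ 5)
    (s : V → ℝ) : ∃ k, ∀ v, motion k (p v) ⬝ᵥ grad m (p v) = s v := by
  let e := Fintype.equivFin V
  have hli := h.linearIndependent_lineVec hV e.symm.injective
  obtain ⟨k, hk⟩ := (linearIndependent_row_iff_surjective
    (Matrix.of fun i => lineVec (p (e.symm i)) (grad m (p (e.symm i))))).1 hli (s ∘ e.symm)
  refine ⟨k, fun v => ?_⟩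
  have := congrFun hk (e v)
  rw [← dotProduct_lineVec, dotProduct_comm]
  simpa [mulVec] using this

/-- Up to two neighbours, the edge vectors and the normal at `v` are independent. For three, a rigid
motion tangential at all vertices except `v` supplies the flex needed to extend over a triangle. -/
theorem GenericOn.loopIndependent_of_nbrs_subset (h : GenericOn m M p)
    (hV : Fintype.card V ≤ 5) {E : Finset (Sym2 V)} (hloop : ∀ e ∈ E, ¬ e.IsDiag) {v : V}
    {T : Finset V} (hT : T.card ≤ 3) (hv : v ∉ T) (hn : nbrs E v ⊆ T)
    (hE : LoopIndependent m c (E.filter (v ∉ ·)) p) : LoopIndependent m c E p := by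
  have hext : (∀ r : V → ℝ, ∀ σ : ℝ, ∃ z : Fin 3 → ℝ, (∀ o ∈ T, z ⬝ᵥ (p v - p o) = r o) ∧
      z ⬝ᵥ grad m (p v) = σ) → LoopIndependent m c E p := by
    intro hz
    rw [← Function.update_eq_self v p]
    refine hE.extend (.zero _ _) (p v) fun u t σ => ?_
    obtain ⟨z, hz1, hz2⟩ := hz (fun o => t o + nbrVal p u v o (p v)) σ
    refine ⟨z, 0, fun o ho => ?_, hz2⟩
    have hoT := hn (mem_nbrs.2 ho)
    have hov : o ≠ v := fun h0 => hv (h0 ▸ hoT)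
    rw [nbrVec, if_neg hov, hz1 o hoT]
    ring
  have hcases : T.card = 0 ∨ T.card = 1 ∨ T.card = 2 ∨ T.card = 3 := by omega
  rcases hcases with h0 | h1 | h2 | h3
  · rw [Finset.card_eq_zero] at h0
    refine hext fun r σ => ?_
    have hg : grad m (p v) ⬝ᵥ grad m (p v) ≠ 0 := fun h0 =>
      h.surface.grad_ne_zero (h.mem v) (dotProduct_self_eq_zero.1 h0)
    exact ⟨(σ / (grad m (p v) ⬝ᵥ grad m (p v))) • grad m (p v), by simp [h0], by
      rw [smul_dotProduct, smul_eq_mul, div_mul_cancel₀ _ hg]⟩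
  · obtain ⟨a, rfl⟩ := Finset.card_eq_one.1 h1
    refine hext fun r σ => ?_
    have hva : v ≠ a := by simpa using hv
    obtain ⟨z, hz1, hz2⟩ := exists_dotProduct_eq_of_cross_ne_zero (h.cross_grad_ne_zero hva) (r a) σ
    exact ⟨z, by simpa using hz1, hz2⟩
  · obtain ⟨a, b, hab, rfl⟩ := Finset.card_eq_two.1 h2
    refine hext fun r σ => ?_
    have hv' : v ≠ a ∧ v ≠ b := by simpa using hv
    obtain ⟨z, hz1, hz2, hz3⟩ := exists_dotProduct_eq_of_triple_ne_zero
      (h.triple_grad_ne_zero hv'.1 hv'.2 hab) (r a) (r b) σ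
    refine ⟨z, ?_, hz3⟩
    simp only [Finset.mem_insert, Finset.mem_singleton, forall_eq_or_imp, forall_eq]
    exact ⟨hz1, hz2⟩
  · obtain ⟨a, b, d, hab, had, hbd, rfl⟩ := Finset.card_eq_three.1 h3
    have hv' : v ≠ a ∧ v ≠ b ∧ v ≠ d := by simpa using hv
    obtain ⟨hva, hvb, hvd⟩ := hv'
    obtain ⟨k, hk⟩ := h.exists_motion_dotProduct_eq hV (Pi.single v 1)
    have hu : ∀ w, w ≠ v → Function.update (fun w => motion k (p w)) v 0 w = motion k (p w) :=
      fun w hw => Function.update_of_ne hw _ _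
    refine hE.extend_triangle hn hva.symm hvb.symm hvd.symm
      (h.triple_ne_zero hva hvb hvd hab had hbd)
      (u := Function.update (fun w => motion k (p w)) v 0) ⟨fun e he => ?_, fun w => ?_⟩
      (hu a hva.symm).symm (hu b hvb.symm).symm (hu d hvd.symm).symm ?_
    · obtain ⟨heE, hve⟩ := Finset.mem_filter.1 he
      have hd := hloop e heE
      induction e with
      | _ x y =>
        simp only [Sym2.mem_iff, not_or] at hve
        rw [pairForm_of_ne m c _ _ (by simpa using hd), hu x (Ne.symm hve.1), hu y (Ne.symm hve.2)]
        exact motion_sub_dotProduct _ _ _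
    · by_cases hw : w = v
      · rw [hw, Function.update_self, zero_dotProduct]
      · rw [hu w hw, hk, Pi.single_eq_of_ne hw]
    · rw [hk, Pi.single_eq_same]
      exact one_ne_zero

/-- Complete graphs on at most four of at most five vertices are independent. -/
theorem GenericOn.loopIndependent_of_subset_sym2 (h : GenericOn m M p)
    (hV : Fintype.card V ≤ 5) {A : Finset V} (hA : A.card ≤ 4) {E : Finset (Sym2 V)}
    (hEA : E ⊆ A.sym2) (hloop : ∀ e ∈ E, ¬ e.IsDiag) : LoopIndependent m c E p := by
  induction A using Finset.induction_on generalizing E with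
  | empty =>
    have : E = ∅ := by simpa using hEA
    subst this
    exact loopIndependent_empty fun v => h.surface.grad_ne_zero (h.mem v)
  | insert v A hv ih =>
    rw [Finset.card_insert_of_notMem hv] at hA
    refine h.loopIndependent_of_nbrs_subset hV hloop (T := A) (by omega) hv (fun o ho => ?_)
      (ih (by omega) (fun e he => ?_) fun e he => hloop e (Finset.mem_filter.1 he).1)
    · have ho' := mem_nbrs.1 ho
      have h1 := hEA ho'
      have h2 := hloop _ ho'
      simp only [Finset.mk_mem_sym2_iff, Finset.mem_insert, Sym2.mk_isDiag_iff] at h1 h2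
      exact h1.2.resolve_left (Ne.symm h2)
    · obtain ⟨he1, he2⟩ := Finset.mem_filter.1 he
      have h1 := Finset.mem_sym2_iff.1 (hEA he1)
      refine Finset.mem_sym2_iff.2 fun a ha => ?_
      refine (Finset.mem_insert.1 (h1 a ha)).resolve_left ?_
      rintro rfl
      exact he2 ha

/-- A graph on five vertices that is not complete is independent. -/
theorem GenericOn.loopIndependent_of_notMem (h : GenericOn m M p) (hV : Fintype.card V = 5)
    {E : Finset (Sym2 V)} (hloop : ∀ e ∈ E, ¬ e.IsDiag) {a b : V} (hab : a ≠ b)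
    (hE : s(a, b) ∉ E) : LoopIndependent m c E p := by
  -- Of the five vertices, `a` can be joined to at most three, and removing it leaves a graph on
  -- four.
  refine h.loopIndependent_of_nbrs_subset hV.le hloop (v := a) (T := {a, b}ᶜ) ?_ (by simp)
    (fun o ho => ?_) (h.loopIndependent_of_subset_sym2 hV.le (A := {a}ᶜ) ?_ (fun e he => ?_)
      fun e he => hloop e (Finset.mem_filter.1 he).1)
  · rw [Finset.card_compl, Finset.card_pair hab, hV]
  · have ho' := mem_nbrs.1 ho
    rw [Finset.mem_compl, Finset.mem_insert, Finset.mem_singleton, not_or]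
    constructor
    · rintro rfl
      exact hloop _ ho' (by simp)
    · rintro rfl
      exact hE ho'
  · rw [Finset.card_compl, Finset.card_singleton, hV]
  · refine Finset.mem_sym2_iff.2 fun x hx => ?_
    rw [Finset.mem_compl, Finset.mem_singleton]
    rintro rfl
    exact (Finset.mem_filter.1 he).2 hx

end Small

/-! ### Independent and rigid frameworks -/

section Rigid

variable {V : Type*} {m : MvPolynomial (Fin 3) ℚ} {M : Set (Fin 3 → ℝ)}
  {c : Fin 3 ⊕ Fin 3 → ℚ} {p u : V → Fin 3 → ℝ}

theorem isRigidMotion_iff : IsRigidMotion p u ↔ ∃ k, ∀ v, u v = motion k (p v) :=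
  ⟨fun ⟨ω, t, h⟩ => ⟨Sum.elim ω t, h⟩, fun ⟨k, h⟩ => ⟨k ∘ Sum.inl, k ∘ Sum.inr, h⟩⟩

theorem IsInfinitesimalFlex.mono {G H : SimpleGraph V} (hGH : G ≤ H)
    (h : IsInfinitesimalFlex m H p u) : IsInfinitesimalFlex m G p u :=
  ⟨h.1, fun a b hab => h.2 a b (hGH hab)⟩

/-- For `1 ≤ n ≤ 4` the number `2n - 1` exceeds `n(n - 1)/2`. -/
theorem IsTight.five_le_card [Fintype V] [Nonempty V] {G : SimpleGraph V} (h : IsTight G 1) :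
    5 ≤ Fintype.card V := by
  classical
  have h1 := h.2
  have h2 := G.card_edgeFinset_le_card_choose_two
  rw [← SimpleGraph.coe_edgeFinset, Set.ncard_coe_finset, Nat.card_eq_fintype_card] at h1
  have hpos : 0 < Fintype.card V := Fintype.card_pos
  generalize Fintype.card V = n at *
  rw [Nat.choose_two_right] at h2
  by_contra! hn
  interval_cases n <;> omega

variable [DecidableEq V]

theorem LoopIndependent.comp_injective {W : Type*} [DecidableEq W] {E : Finset (Sym2 V)}
    (h : LoopIndependent m c E p) {f : W → V} (hf : Function.Injective f) {F : Finset (Sym2 W)}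
    (hF : ∀ e ∈ F, e.map f ∈ E) : LoopIndependent m c F (p ∘ f) := by
  intro t s
  obtain ⟨u, hu1, hu2⟩ := h (Function.extend (Sym2.map f) t 0) (Function.extend f s 0)
  refine ⟨u ∘ f, fun e he => ?_, fun w => ?_⟩
  · have h1 := hu1 _ (hF e he)
    rw [(Sym2.map.injective hf).extend_apply] at h1
    rw [← h1]
    induction e with
    | _ a b => simp only [Sym2.map_mk, pairForm_mk, Function.comp_apply, hf.eq_iff]
  · have h2 := hu2 (f w)
    rwa [hf.extend_apply] at h2

variable [Fintype V]

/-- `c` enters only through loops, which a simple graph lacks, so any value serves, including 0 when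
no slide is at hand. -/
theorem isIndependent_iff_loopIndependent (c : Fin 3 ⊕ Fin 3 → ℚ) {G : SimpleGraph V}
    [Fintype G.edgeSet] : IsIndependent m G p ↔ LoopIndependent m c G.edgeFinset p := by
  classical
  rw [IsIndependent, linearIndependent_row_iff_surjective]
  have hedge : ∀ (e : Sym2 V), e ∈ G.edgeSet → ∀ x : V × Fin 3 → ℝ,
      edgeRow p e ⬝ᵥ x = pairForm m c p (fun v i => x (v, i)) e := by
    intro e he x
    induction e with
    | _ a b => rw [edgeRow_dotProduct, pairForm_of_ne m c _ _ (G.ne_of_adj he)]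
  constructor
  · intro h t s
    obtain ⟨x, hx⟩ := h (Sum.elim (fun e => t e) s)
    refine ⟨fun v i => x (v, i), fun e he => ?_, fun v => ?_⟩
    · rw [SimpleGraph.mem_edgeFinset] at he
      rw [← hedge e he]
      exact congrFun hx (Sum.inl ⟨e, he⟩)
    · rw [← vertexRow_dotProduct]
      exact congrFun hx (Sum.inr v)
  · intro h y
    obtain ⟨u, hu1, hu2⟩ := h (fun e => if he : e ∈ G.edgeSet then y (Sum.inl ⟨e, he⟩) else 0)
      fun v => y (Sum.inr v)
    refine ⟨fun q => u q.1 q.2, ?_⟩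
    ext (⟨e, he⟩ | v)
    · refine (hedge e he _).trans ((hu1 e (SimpleGraph.mem_edgeFinset.2 he)).trans ?_)
      rw [dif_pos he]
    · exact (vertexRow_dotProduct _ _ _ _).trans (hu2 v)

theorem IsIndependent.ncard_add_finrank_ker {G : SimpleGraph V} (h : IsIndependent m G p) :
    G.edgeSet.ncard + Fintype.card V +
      Module.finrank ℝ (LinearMap.ker (rigidityMatrix m G p).mulVecLin) =
        3 * Fintype.card V := by
  classical
  have := card_add_finrank_ker_of_linearIndependent h
  rw [Fintype.card_sum, Fintype.card_prod, Fintype.card_fin] at this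
  rw [← Nat.card_coe_set_eq, Nat.card_eq_fintype_card]
  omega

theorem one_le_finrank_ker (ht : HasType m M 1) (hp : ∀ v, p v ∈ M) (hV : 2 ≤ Fintype.card V)
    (G : SimpleGraph V) :
    1 ≤ Module.finrank ℝ (LinearMap.ker (rigidityMatrix m G p).mulVecLin) := by
  obtain ⟨u, hu0, hu⟩ := ht.exists_flex hV hp
  refine Module.finrank_pos_iff_exists_ne_zero.2
    ⟨⟨fun q => u q.1 q.2, mem_ker_rigidityMatrix.2 (hu.mono le_top)⟩, fun h0 => hu0 ?_⟩
  ext v i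
  exact congrFun (congrArg Subtype.val h0) (v, i)

theorem IsIndependent.ncard_add_one_le {G : SimpleGraph V} (h : IsIndependent m G p)
    (ht : HasType m M 1) (hp : ∀ v, p v ∈ M) (hV : 2 ≤ Fintype.card V) :
    G.edgeSet.ncard + 1 ≤ 2 * Nat.card V := by
  have h1 := h.ncard_add_finrank_ker
  have h2 := one_le_finrank_ker ht hp hV G
  rw [Nat.card_eq_fintype_card]
  omega

/-- Independence passes to subgraphs, and each kernel contains the flex of a complete framework. The
edge of `H` provides the two vertices needed for the type to apply. -/
theorem IsIndependent.isSparse {G : SimpleGraph V} (h : IsIndependent m G p)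
    (ht : HasType m M 1) (hp : ∀ v, p v ∈ M) : IsSparse G 1 := by
  classical
  intro H hH
  have hF : IsIndependent m H.coe (p ∘ Subtype.val) := by
    rw [isIndependent_iff_loopIndependent 0] at h ⊢
    refine h.comp_injective Subtype.val_injective fun e he => ?_
    rw [SimpleGraph.mem_edgeFinset] at he ⊢
    refine H.edgeSet_subset ?_
    rw [← SimpleGraph.Subgraph.image_coe_edgeSet_coe]
    exact Set.mem_image_of_mem _ he
  have hcard : 2 ≤ Fintype.card H.verts := by
    obtain ⟨e, he⟩ := hH
    induction e with
    | _ a b =>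
      have hab : H.Adj a b := he
      have : (⟨a, hab.fst_mem⟩ : H.verts) ≠ ⟨b, hab.snd_mem⟩ := fun h0 =>
        hab.ne (congrArg Subtype.val h0)
      exact Fintype.one_lt_card_iff.2 ⟨_, _, this⟩
  have h1 := hF.ncard_add_one_le ht (fun v => hp _) hcard
  rw [← SimpleGraph.Subgraph.image_coe_edgeSet_coe,
    Set.ncard_image_of_injective _ (Sym2.map.injective Subtype.val_injective),
    ← Nat.card_coe_set_eq H.verts]
  push_cast
  omega

/-- Each flex comes from a rigid motion tangential at five generic points, and such motions form a
space of dimension `6 - 5 = 1`. -/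
theorem GenericOn.finrank_ker_le_one (h : GenericOn m M p) (hV : 5 ≤ Fintype.card V)
    {G : SimpleGraph V} (hG : IsInfinitesimallyRigid m G p) :
    Module.finrank ℝ (LinearMap.ker (rigidityMatrix m G p).mulVecLin) ≤ 1 := by
  obtain ⟨v⟩ : Nonempty (Fin 5 ↪ V) := Function.Embedding.nonempty_of_card_le (by simpa using hV)
  set A : Matrix (Fin 5) (Fin 3 ⊕ Fin 3) ℝ :=
    Matrix.of fun i => lineVec (p (v i)) (grad m (p (v i))) with hA
  have hli : LinearIndependent ℝ A.row := h.linearIndependent_lineVec le_rfl v.injective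
  have hcard := card_add_finrank_ker_of_linearIndependent hli
  simp only [Fintype.card_sum, Fintype.card_fin] at hcard
  let Φ : (Fin 3 ⊕ Fin 3 → ℝ) →ₗ[ℝ] (V × Fin 3 → ℝ) :=
    { toFun := fun k q => motion k (p q.1) q.2
      map_add' := fun k k' => by ext q; simp only [motion_add, Pi.add_apply]
      map_smul' := fun r k => by
        ext q; simp only [motion_smul, Pi.smul_apply, RingHom.id_apply] }
  have hle : LinearMap.ker (rigidityMatrix m G p).mulVecLin ≤
      (LinearMap.ker A.mulVecLin).map Φ := by
    intro x hx
    rw [mem_ker_rigidityMatrix] at hx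
    obtain ⟨k, hk⟩ := isRigidMotion_iff.1 (hG _ hx)
    refine ⟨k, ?_, ?_⟩
    · rw [SetLike.mem_coe, LinearMap.mem_ker, mulVecLin_apply]
      ext i
      change lineVec (p (v i)) (grad m (p (v i))) ⬝ᵥ k = 0
      rw [dotProduct_comm, dotProduct_lineVec, ← hk]
      exact hx.1 (v i)
    · ext ⟨w, i⟩
      exact (congrFun (hk w) i).symm
  have h1 := Submodule.finrank_mono hle
  have h2 := Submodule.finrank_map_le Φ (LinearMap.ker A.mulVecLin)
  omega

theorem GenericOn.isTight_of_isIsostatic (h : GenericOn m M p) (hV : 5 ≤ Fintype.card V)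
    {G : SimpleGraph V} (hG : IsIsostatic m G p) : IsTight G 1 := by
  refine ⟨hG.1.isSparse h.type_one h.mem, ?_⟩
  have h1 := hG.1.ncard_add_finrank_ker
  have h2 := one_le_finrank_ker h.type_one h.mem (by omega) G
  have h3 := h.finrank_ker_le_one hV hG.2
  rw [Nat.card_eq_fintype_card]
  push_cast
  omega

theorem GenericOn.isRigidMotion_of_top (h : GenericOn m M p) (hV : 4 ≤ Fintype.card V)
    (hu : IsInfinitesimalFlex m ⊤ p u) : IsRigidMotion p u := by
  obtain ⟨v⟩ : Nonempty (Fin 4 ↪ V) := Function.Embedding.nonempty_of_card_le (by simpa using hV)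
  have hv : ∀ i j, i ≠ j → v i ≠ v j := fun i j => v.injective.ne
  exact isRigidMotion_iff.2 (exists_motion_of_complete (isInfinitesimalFlex_top.1 hu).2
    (h.triple_ne_zero (hv 0 1 (by decide)) (hv 0 2 (by decide)) (hv 0 3 (by decide))
      (hv 1 2 (by decide)) (hv 1 3 (by decide)) (hv 2 3 (by decide))))

/-- With `d = a - b` and `w = x - y` orthogonal to `d`, the angular velocity `(d × w)/|d|²` works,
because `(d × w) × d = |d|² w`. -/
theorem exists_cross_add_eq {a b x y : Fin 3 → ℝ} (hab : a ≠ b)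
    (h : (x - y) ⬝ᵥ (a - b) = 0) : ∃ ω t : Fin 3 → ℝ, x = ω ⨯₃ a + t ∧ y = ω ⨯₃ b + t := by
  have hN : (a - b) ⬝ᵥ (a - b) ≠ 0 := fun h0 =>
    hab (sub_eq_zero.1 (dotProduct_self_eq_zero.1 h0))
  set d := a - b with hd
  set w := x - y with hw
  set N := d ⬝ᵥ d with hN'
  have key : (d ⨯₃ w) ⨯₃ d = N • w := by
    rw [cross_cross_eq_smul_sub_smul, h, zero_smul, sub_zero]
  refine ⟨N⁻¹ • (d ⨯₃ w), y - (N⁻¹ • (d ⨯₃ w)) ⨯₃ b, ?_, by abel⟩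
  have : (N⁻¹ • (d ⨯₃ w)) ⨯₃ a - (N⁻¹ • (d ⨯₃ w)) ⨯₃ b = w := by
    rw [← map_sub, ← hd, map_smul, LinearMap.smul_apply, key, smul_smul, inv_mul_cancel₀ hN,
      one_smul]
  rw [add_sub_left_comm, this, hw]
  abel

theorem GenericOn.isInfinitesimallyRigid_top (h : GenericOn m M p) :
    IsInfinitesimallyRigid m ⊤ p := by
  intro u hu
  have hu' := (isInfinitesimalFlex_top.1 hu).2
  have hcases : Fintype.card V = 0 ∨ Fintype.card V = 1 ∨ Fintype.card V = 2 ∨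
      Fintype.card V = 3 ∨ 4 ≤ Fintype.card V := by omega
  simp only [← Finset.card_univ (α := V)] at hcases
  rcases hcases with h0 | h1 | h2 | h3 | h4
  · rw [Finset.card_eq_zero, Finset.univ_eq_empty_iff] at h0
    exact ⟨0, 0, fun v => h0.elim v⟩
  · obtain ⟨a, ha⟩ := Finset.card_eq_one.1 h1
    refine ⟨0, u a, fun v => ?_⟩
    have : v = a := by simpa [ha] using Finset.mem_univ v
    simp [this]
  · obtain ⟨a, b, hab, hV⟩ := Finset.card_eq_two.1 h2
    have hp : p a ≠ p b := by
      intro h0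
      apply h.cross_grad_ne_zero hab
      rw [h0, sub_self, map_zero, LinearMap.zero_apply]
    obtain ⟨ω, t, h1, h2⟩ := exists_cross_add_eq hp (hu' a b)
    refine ⟨ω, t, fun v => ?_⟩
    have : v = a ∨ v = b := by simpa [hV] using Finset.mem_univ v
    rcases this with rfl | rfl <;> assumption
  · obtain ⟨a, b, d, hab, had, hbd, hV⟩ := Finset.card_eq_three.1 h3
    have hn : (p b - p a) ⨯₃ (p d - p a) ≠ 0 := by
      intro h0
      apply h.triple_grad_ne_zero hab had hbd
      rw [triple, triple_product_permutation, triple_product_permutation, ← neg_sub (p b),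
        ← neg_sub (p d), map_neg, map_neg, LinearMap.neg_apply, neg_neg, h0, dotProduct_zero]
    obtain ⟨k, hka, hkb, hkd, -⟩ := exists_motion_of_triangle hn (hu' a b) (hu' a d) (hu' b d)
    refine isRigidMotion_iff.2 ⟨k, fun v => ?_⟩
    have : v = a ∨ v = b ∨ v = d := by simpa [hV] using Finset.mem_univ v
    rcases this with rfl | rfl | rfl <;> simp only [*]
  · exact h.isRigidMotion_of_top h4 hu

theorem GenericOn.isIsostatic_top (h : GenericOn m M p) (hV : Fintype.card V ≤ 4) :
    IsIsostatic m ⊤ p := by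
  classical
  refine ⟨(isIndependent_iff_loopIndependent 0).2 ?_, h.isInfinitesimallyRigid_top⟩
  exact h.loopIndependent_of_subset_sym2 (by omega) (A := Finset.univ) hV (by simp)
    fun e he => SimpleGraph.not_isDiag_of_mem_edgeFinset he

/-- The complete graph is independent, so some tangential velocities violate the constraint of a
missing edge `ab` alone. They form a flex of `G` that is not a rigid motion. -/
theorem GenericOn.eq_top_of_isInfinitesimallyRigid (h : GenericOn m M p)
    (hV : Fintype.card V ≤ 4) {G : SimpleGraph V} (hG : IsInfinitesimallyRigid m G p) :
    G = ⊤ := by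
  classical
  rw [eq_top_iff]
  intro a b hab
  rw [SimpleGraph.top_adj] at hab
  by_contra hn
  have hI : LoopIndependent m 0 (⊤ : SimpleGraph V).edgeFinset p :=
    (isIndependent_iff_loopIndependent 0).1 (h.isIsostatic_top hV).1
  obtain ⟨u, hu1, hu2⟩ := hI (fun e => if e = s(a, b) then 1 else 0) 0
  have key : ∀ x y, x ≠ y → (u x - u y) ⬝ᵥ (p x - p y) = if s(x, y) = s(a, b) then 1 else 0 := by
    intro x y hxy
    rw [← pairForm_of_ne m 0 p u hxy]
    exact hu1 _ (by simpa using hxy)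
  obtain ⟨k, hk⟩ := isRigidMotion_iff.1 (hG u ⟨hu2, fun x y hxy => by
    rw [← sub_eq_zero, ← sub_dotProduct, key x y hxy.ne, if_neg]
    intro h0
    apply hn
    rw [← SimpleGraph.mem_edgeSet, ← h0]
    exact hxy⟩)
  have h1 := key a b hab
  rw [if_pos rfl, hk, hk, motion_sub_dotProduct] at h1
  exact zero_ne_one h1

theorem IsSparse.loopSparse {G : SimpleGraph V} [Fintype G.edgeSet] (h : IsSparse G 1) :
    LoopSparse G.edgeFinset := by
  intro S hS
  have hpos := hS.card_pos
  rcases (edgesIn G.edgeFinset S).eq_empty_or_nonempty with h0 | ⟨e₀, he₀⟩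
  · rw [h0, Finset.card_empty]
    omega
  let H : G.Subgraph := (⊤ : G.Subgraph).induce S
  have hsub : (↑(edgesIn G.edgeFinset S) : Set (Sym2 V)) ⊆ H.edgeSet := by
    intro e he
    obtain ⟨h1, h2⟩ := mem_edgesIn.1 he
    rw [SimpleGraph.mem_edgeFinset] at h1
    induction e with
    | _ a b =>
      rw [Finset.mk_mem_sym2_iff] at h2
      exact ⟨h2.1, h2.2, h1⟩
  have h1 := h H ⟨e₀, hsub he₀⟩
  have h2 := Set.ncard_le_ncard hsub (Set.toFinite _)
  rw [Set.ncard_coe_finset] at h2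
  have h3 : H.verts.ncard = S.card := Set.ncard_coe_finset S
  rw [h3] at h1
  push_cast at h1
  omega

/-- Five vertices are too few to guarantee a rational slide, but there nine edges leave a pair
unjoined. From six vertices on, the induction on graphs with loops applies. -/
theorem GenericOn.isIndependent_of_isTight [Nonempty V] (h : GenericOn m M p)
    {G : SimpleGraph V} (hG : IsTight G 1) : IsIndependent m G p := by
  classical
  have hloop : ∀ e ∈ G.edgeFinset, ¬ e.IsDiag := fun e he =>
    SimpleGraph.not_isDiag_of_mem_edgeFinset he
  rcases hG.five_le_card.eq_or_lt with h5 | h6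
  · obtain ⟨a, b, hab, hn⟩ : ∃ a b, a ≠ b ∧ ¬ G.Adj a b := by
      by_contra! hcon
      have htop : G = ⊤ := eq_top_iff.2 fun a b hab => hcon a b hab
      have h1 := hG.2
      have h2 : G.edgeFinset.card = (Fintype.card V).choose 2 := by
        subst htop
        convert SimpleGraph.card_edgeFinset_top_eq_card_choose_two (V := V)
      rw [← SimpleGraph.coe_edgeFinset, Set.ncard_coe_finset, Nat.card_eq_fintype_card, h2,
        ← h5, Nat.choose_two_right] at h1
      omega
    exact (isIndependent_iff_loopIndependent 0).2
      (h.loopIndependent_of_notMem h5.symm hloop hab (by simpa using hn))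
  · obtain ⟨c, hc0, hc⟩ := h.type_one.exists_rational_slide h6 h.surface h.mem h.generic
    exact (isIndependent_iff_loopIndependent c).2
      (h.loopIndependent ⟨hc0, hc⟩ _ hG.1.loopSparse)

/-- Tightness makes the kernel one-dimensional, so it is spanned by the nonzero flex of the complete
framework. That flex is a rigid motion because four generic points are not coplanar. -/
theorem GenericOn.isIsostatic_of_isTight [Nonempty V] (h : GenericOn m M p)
    {G : SimpleGraph V} (hG : IsTight G 1) : IsIsostatic m G p := by
  have hI := h.isIndependent_of_isTight hG
  have h5 := hG.five_le_card
  refine ⟨hI, fun u hu => ?_⟩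
  have h1 := hI.ncard_add_finrank_ker
  have h2 := hG.2
  rw [Nat.card_eq_fintype_card] at h2
  push_cast at h2
  have h3 : Module.finrank ℝ (LinearMap.ker (rigidityMatrix m G p).mulVecLin) = 1 := by omega
  obtain ⟨w, hw0, hw⟩ := h.type_one.exists_flex (by omega) h.mem
  obtain ⟨k, hk⟩ := isRigidMotion_iff.1 (h.isRigidMotion_of_top (by omega) hw)
  obtain ⟨l, hl⟩ := (finrank_eq_one_iff_of_nonzero'
    (⟨fun q => w q.1 q.2, mem_ker_rigidityMatrix.2 (hw.mono le_top)⟩ :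
      LinearMap.ker (rigidityMatrix m G p).mulVecLin) (fun h0 => hw0 (by
        ext v i
        exact congrFun (congrArg Subtype.val h0) (v, i)))).1 h3
    ⟨fun q => u q.1 q.2, mem_ker_rigidityMatrix.2 hu⟩
  refine isRigidMotion_iff.2 ⟨l • k, fun v => ?_⟩
  rw [motion_smul, ← hk]
  ext i
  exact (congrFun (congrArg Subtype.val hl) (v, i)).symm

end Rigid

end SurfaceFramework

end

/-! ### The characterization of generic isostatic frameworks -/

theorem theorem1p1 {V : Type*} [Fintype V] [DecidableEq V] [Nonempty V]
    (G : SimpleGraph V)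
    (m : MvPolynomial (Fin 3) ℚ) (M : Set (Fin 3 → ℝ))
    (hM : SurfaceFramework.IsIrreducibleSurface m M)
    (htype : SurfaceFramework.HasType m M 1)
    (p : V → Fin 3 → ℝ) (hp : ∀ v, p v ∈ M)
    (hgen : SurfaceFramework.IsGeneric m p) :
    SurfaceFramework.IsIsostatic m G p ↔
      (∃ n ∈ ({1, 2, 3, 4} : Set ℕ), Nonempty (G ≃g (⊤ : SimpleGraph (Fin n)))) ∨
        SurfaceFramework.IsTight G 1 := by
  have h : SurfaceFramework.GenericOn m M p := ⟨hM, htype, hp, hgen⟩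
  constructor
  · intro hG
    rcases Nat.lt_or_ge 4 (Fintype.card V) with h5 | h4
    · exact Or.inr (h.isTight_of_isIsostatic h5 hG)
    · left
      have hpos : 0 < Fintype.card V := Fintype.card_pos
      refine ⟨Fintype.card V, ?_, ?_⟩
      · simp only [Set.mem_insert_iff, Set.mem_singleton_iff]
        omega
      · rw [h.eq_top_of_isInfinitesimallyRigid h4 hG.2]
        exact ⟨SimpleGraph.Iso.completeGraph (Fintype.equivFin V)⟩
  · rintro (⟨n, hn, ⟨f⟩⟩ | hG)
    · have hcard : Fintype.card V = n := by
        rw [Fintype.card_congr f.toEquiv, Fintype.card_fin]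
      have htop : G = ⊤ := by
        rw [eq_top_iff]
        intro a b hab
        rw [← f.map_adj_iff]
        exact f.injective.ne hab
      rw [htop]
      refine h.isIsostatic_top ?_
      simp only [Set.mem_insert_iff, Set.mem_singleton_iff] at hn
      omega
    · exact h.isIsostatic_of_isTight hG
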